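/- Let $F$ be a non-Archimedean local field with ring of integers $\mathfrak o$, maximal ideal $\mathfrak p=(\varpi)$, residue field $\mathbb F_q$, and put $\mathfrak o_k=\mathfrak o/\mathfrak p^k$. Let $G=\mathrm{GL}_4(\mathfrak o_2)$, let $N_1$ be the kernel of reduction $G\to\mathrm{GL}_4(\mathbb F_q)$, and let $\psi:F\to\mathbb C^\times$ be an additive character that is trivial on $\mathfrak o$ but not on $\mathfrak p^{-1}$. For $\beta\in M_4(\mathbb F_q)$ let $\psi_\beta$ be the character $\psi_\beta(1+\varpi x)=\psi(\varpi^{-1}\mathrm{Tr}(\beta x))$ of $N_1$, and let $G(\psi_\beta)$ be its stabilizer in $G$ under conjugation. The orbit of an irreducible complex representation $\pi$ of $G$ is the set of all $\beta$ such that $\psi_\beta$ occurs in $\pi|_{N_1}$. For $0<n_1<n$, let $P_{n_1,n-n_1}\subset \mathrm{GL}_n(\mathfrak o_k)$ be the stabilizer of $\mathfrak o_k^{n_1}\subset\mathfrak o_k^n$ (the span of the first $n_1$ standard basis vectors), with natural map to $\mathrm{Aut}(\mathfrak o_k^{n_1})\times\mathrm{Aut}(\mathfrak o_k^n/\mathfrak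 o_k^{n_1})$, and let $U_{n_1,n-n_1}$ be the kernel of this map. For a partition $\lambda=(\lambda_1\ge\dots\ge\lambda_n\ge 0)$ of a positive integer with $\lambda_1\le k$ and $\lambda\ne(k^n)$, embed $\mathfrak o_\lambda=\bigoplus_i\mathfrak o_{\lambda_i}$ in $\mathfrak o_k^n$ as $\bigoplus_i\mathfrak p^{k-\lambda_i}e_i$, and let $P_\lambda$ be its stabilizer, with natural map to $\mathrm{Aut}(\mathfrak o_\lambda)$. An irreducible representation of $\mathrm{GL}_n(\mathfrak o_k)$ is called cuspidal if no twist of it by a linear character is isomorphic to a subrepresentation of a representation induced from some $P_{n_1,n-n_1}$ of the pull-back of some $\sigma_1\otimes\sigma_2$, or of a representation induced from some $P_\lambda$ of the pull-back of some representation of $\mathrm{Aut}(\mathfrak o_\lambda)$. An irreducible representation of $G=\mathrm{GL}_4(\mathfrak o_2)$ is called strongly cuspidal if the matrices in its orbit leave no non-trivial proper subspace of $\mathbb F_q^4$ invariant. Let $\eta$ generate $\mathbb F_{q^2}$ over $\mathbb F_q$, regard $\mathbb F_{q^2}$ as a subring of $M_2(\mathbb F_q)$ via the basis $\{1,\eta\}$,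 and let $\beta_1=\begin{pmatrix}\eta&1\\0&\eta\end{pmatrix}\in M_4(\mathbb F_q)$. Then the following hold. 1. Every irreducible representation $\pi$ of $G$ whose orbit contains $\beta_1$ is isomorphic to $\mathrm{Ind}_{G(\psi_{\beta_1})}^G\rho$ for a unique one-dimensional representation $\rho$ of $G(\psi_{\beta_1})$ with $\rho|_{N_1}=\psi_{\beta_1}$. 2. Let $\pi$ be an irreducible representation of $G$ whose orbit contains $\beta_1$, and let $\rho$ be an irreducible representation of $G(\psi_{\beta_1})$ such that $\rho|_{N_1}$ contains $\psi_{\beta_1}$ and $\pi\cong\mathrm{Ind}_{G(\psi_{\beta_1})}^G\rho$. Then $\pi$ is cuspidal if and only if the restriction of $\rho$ to $G(\psi_{\beta_1})\cap U_{2,2}$ does not contain the trivial representation. 3. The map $\rho\mapsto\mathrm{Ind}_{G(\psi_{\beta_1})}^G\rho$ is a bijection from the set of isomorphism classes of irreducible representations $\rho$ of $G(\psi_{\beta_1})$ such that $\rho|_{N_1}$ contains $\psi_{\beta_1}$ and $\rho|_{G(\psi_{\beta_1})\cap U_{2,2}}$ does not contain the trivial representation, onto the set of isomorphism classes of cuspidal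 representations of $G$ whose orbit contains $\beta_1$. 4. There is a cuspidal representation of $G$ whose orbit contains $\beta_1$ and which is not strongly cuspidal. -/

import Mathlib

open scoped ValuativeRel

universe u v w

noncomputable section

namespace CuspidalGL

/-! ### Representations of finite groups -/

section Rep

variable {G : Type*} [Group G] {V : Type*} [AddCommGroup V] [Module ℂ V]

/-- The twist `π ⊗ χ` of a representation by a linear character. -/
def twist (χ : G →* ℂˣ) (π : Representation ℂ G V) : Representation ℂ G V where
  toFun g := (χ g : ℂ) • π g
  map_one' := by simp
  map_mul' g h := by
    ext v
    simp only [map_mul, Units.val_mul, mul_smul, LinearMap.smul_apply, Module.End.mul_apply,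
      map_smul]
    rw [smul_comm]

/-- A linear character, viewed as a one-dimensional representation. -/
def charRep (χ : G →* ℂˣ) : Representation ℂ G ℂ :=
  twist χ (Representation.trivial ℂ G ℂ)

/-- `π` is isomorphic to a subrepresentation of `τ`. -/
def IsSubrepOf {W : Type*} [AddCommGroup W] [Module ℂ W]
    (π : Representation ℂ G V) (τ : Representation ℂ G W) : Prop :=
  ∃ f : Representation.IntertwiningMap π τ, Function.Injective f

/-- The restriction of `π` to the subgroup `H` contains the trivial representation of `H`. -/
def ContainsTrivial (π : Representation ℂ G V) (H : Subgroup G) : Prop :=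
  ∃ v : V, v ≠ 0 ∧ ∀ h ∈ H, π h v = v

end Rep

/-! ### Stabilizers of submodules -/

section Stabilizer

variable {A : Type*} [CommRing A] {n : ℕ}

/-- `GL_n(A)` acting on column vectors, as linear automorphisms of `A^n`. -/
def glAut (A : Type*) [CommRing A] (n : ℕ) :
    Matrix.GeneralLinearGroup (Fin n) A →* ((Fin n → A) ≃ₗ[A] (Fin n → A)) :=
  (LinearMap.GeneralLinearGroup.generalLinearEquiv A (Fin n → A)).toMonoidHom.comp
    (Matrix.GeneralLinearGroup.toLin (n := Fin n) (R := A)).toMonoidHom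

theorem glAut_apply (g : Matrix.GeneralLinearGroup (Fin n) A) (v : Fin n → A) :
    glAut A n g v = (g : Matrix (Fin n) (Fin n) A).mulVec v := rfl

/-- The group `P_L` of all `g` in `GL_n(A)` with `g L = L`. -/
def stab (L : Submodule A (Fin n → A)) : Subgroup (Matrix.GeneralLinearGroup (Fin n) A) where
  carrier := {g | L.map (glAut A n g : (Fin n → A) →ₗ[A] (Fin n → A)) = L}
  one_mem' := by
    simp only [Set.mem_ofPred_eq, map_one]
    exact Submodule.map_id L
  mul_mem' {g h} hg hh := by
    simp only [Set.mem_ofPred_eq] at hg hh ⊢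
    rw [map_mul]
    change L.map ((glAut A n g : (Fin n → A) →ₗ[A] (Fin n → A)) ∘ₗ
      (glAut A n h : (Fin n → A) →ₗ[A] (Fin n → A))) = L
    rw [Submodule.map_comp, hh, hg]
  inv_mem' {g} hg := by
    simp only [Set.mem_ofPred_eq] at hg ⊢
    conv_lhs => rw [← hg]
    rw [← Submodule.map_comp]
    have h : ((glAut A n g⁻¹ : (Fin n → A) →ₗ[A] (Fin n → A)) ∘ₗ
        (glAut A n g : (Fin n → A) →ₗ[A] (Fin n → A))) = LinearMap.id := by
      refine LinearMap.ext fun v => ?_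
      change (glAut A n g⁻¹ * glAut A n g) v = v
      rw [← map_mul, inv_mul_cancel, map_one]
      rfl
    rw [h, Submodule.map_id]

/-- The action of `P_L` on `L`. -/
def resHom (L : Submodule A (Fin n → A)) : stab L →* (L ≃ₗ[A] L) where
  toFun g := (glAut A n g).ofSubmodules L L g.2
  map_one' := by
    ext x
    simp [LinearEquiv.ofSubmodules_apply]
  map_mul' g h := by
    refine LinearEquiv.ext fun x => Subtype.ext ?_
    change glAut A n ((g : Matrix.GeneralLinearGroup (Fin n) A) * h) x =
      glAut A n g (glAut A n h x)
    rw [map_mul]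
    rfl

/-- The action of `P_L` on `A^n / L`. -/
def quotHom (L : Submodule A (Fin n → A)) :
    stab L →* (((Fin n → A) ⧸ L) ≃ₗ[A] ((Fin n → A) ⧸ L)) where
  toFun g := Submodule.Quotient.equiv L L (glAut A n g) g.2
  map_one' := by
    ext x
    induction x using Submodule.Quotient.induction_on
    simp
  map_mul' g h := by
    refine LinearEquiv.ext fun x => ?_
    induction x using Submodule.Quotient.induction_on with
    | H v =>
      change Submodule.Quotient.mk
          (glAut A n ((g : Matrix.GeneralLinearGroup (Fin n) A) * h) v) =
        Submodule.Quotient.mk (glAut A n g (glAut A n h v))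
      rw [map_mul]
      rfl

/-- The submodule `A^{n₁}` of `A^n` spanned by the first `n₁` basis vectors. -/
def coordSub (A : Type*) [CommRing A] (n n₁ : ℕ) : Submodule A (Fin n → A) where
  carrier := {v | ∀ i : Fin n, n₁ ≤ (i : ℕ) → v i = 0}
  zero_mem' := by simp
  add_mem' {v w} hv hw := fun i hi => by simp [hv i hi, hw i hi]
  smul_mem' c v hv := fun i hi => by simp [hv i hi]

/-- The geometric unipotent group `U_{n₁, n - n₁}`: the kernel of
`P_{n₁, n - n₁} → Aut(A^{n₁}) × Aut(A^n / A^{n₁})`. -/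
def geomU (A : Type*) [CommRing A] (n n₁ : ℕ) :
    Subgroup (Matrix.GeneralLinearGroup (Fin n) A) :=
  ((resHom (coordSub A n n₁)).prod (quotHom (coordSub A n n₁))).ker.map
    (stab (coordSub A n n₁)).subtype

end Stabilizer

/-! ### Cuspidal representations of `GL_n(𝔬_k)`

Throughout, `O` is a local ring (in the application the ring of integers of a local field),
`𝔬_k = O / 𝔭^k` with `𝔭` the maximal ideal. -/

section Cuspidal

variable (O : Type*) [CommRing O] [IsLocalRing O]

/-- The ring `𝔬_k = O / 𝔭^k`. -/
abbrev oMod (k : ℕ) : Type _ := O ⧸ (IsLocalRing.maximalIdeal O ^ k)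

/-- The group `GL_n(𝔬_k)`. -/
abbrev GLo (n k : ℕ) : Type _ := Matrix.GeneralLinearGroup (Fin n) (oMod O k)

variable {O} {n k : ℕ}

/-- The geometric induction `i_{n₁, n - n₁}(σ₁, σ₂)`: the pull-back of the external tensor product
`σ₁ ⊗ σ₂` to `P_{n₁, n - n₁}`, induced to `GL_n(𝔬_k)`.  Here `Aut(𝔬_k^{n₁})` and
`Aut(𝔬_k^n / 𝔬_k^{n₁})` are the two general linear groups of the Levi quotient. -/
def geomInd (n₁ : ℕ) {W₁ W₂ : Type*} [AddCommGroup W₁] [Module ℂ W₁] [AddCommGroup W₂]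
    [Module ℂ W₂]
    (σ₁ : Representation ℂ
      (coordSub (oMod O k) n n₁ ≃ₗ[oMod O k] coordSub (oMod O k) n n₁) W₁)
    (σ₂ : Representation ℂ (((Fin n → oMod O k) ⧸ coordSub (oMod O k) n n₁) ≃ₗ[oMod O k]
      ((Fin n → oMod O k) ⧸ coordSub (oMod O k) n n₁)) W₂) :
    Representation ℂ (GLo O n k)
      (Representation.IndV (stab (coordSub (oMod O k) n n₁)).subtype
        (Representation.tprod (σ₁.comp (resHom _)) (σ₂.comp (quotHom _)))) :=
  Representation.ind (stab (coordSub (oMod O k) n n₁)).subtype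
    (Representation.tprod (σ₁.comp (resHom _)) (σ₂.comp (quotHom _)))

/-- `π` lies in the geometrically induced series. -/
def IsGeomInduced {V : Type*} [AddCommGroup V] [Module ℂ V]
    (π : Representation ℂ (GLo O n k) V) : Prop :=
  ∃ n₁ : ℕ, 0 < n₁ ∧ n₁ < n ∧
    ∃ (W₁ : Type) (_ : AddCommGroup W₁) (_ : Module ℂ W₁) (_ : FiniteDimensional ℂ W₁)
      (W₂ : Type) (_ : AddCommGroup W₂) (_ : Module ℂ W₂) (_ : FiniteDimensional ℂ W₂)
      (σ₁ : Representation ℂ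
        (coordSub (oMod O k) n n₁ ≃ₗ[oMod O k] coordSub (oMod O k) n n₁) W₁)
      (σ₂ : Representation ℂ (((Fin n → oMod O k) ⧸ coordSub (oMod O k) n n₁) ≃ₗ[oMod O k]
        ((Fin n → oMod O k) ⧸ coordSub (oMod O k) n n₁)) W₂),
      IsSubrepOf π (geomInd n₁ σ₁ σ₂)

/-- The image of the standard embedding `𝔬_Λ ↪ 𝔬_k^n`, `f_i ↦ ϖ^{k - Λ_i} e_i`, that is, the
submodule `⊕ 𝔭^{k - Λ_i} e_i`. -/
def embSub (O : Type*) [CommRing O] [IsLocalRing O] (n k : ℕ) (Λ : Fin n → ℕ) :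
    Submodule (oMod O k) (Fin n → oMod O k) where
  carrier := {v | ∀ i, v i ∈ (IsLocalRing.maximalIdeal O ^ (k - Λ i)).map
    (Ideal.Quotient.mk (IsLocalRing.maximalIdeal O ^ k))}
  zero_mem' := fun _ => Ideal.zero_mem _
  add_mem' hv hw := fun i => Ideal.add_mem _ (hv i) (hw i)
  smul_mem' c _ hv := fun i => Ideal.mul_mem_left _ c (hv i)

/-- `Λ` is a partition of a positive integer (padded by zeros to length `n`) with
`𝔬_Λ` embeddable in `𝔬_k^n` and `Λ ≠ (k^n)`, i.e. `Λ < k^n`. -/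
def IsProperPartition (n k : ℕ) (Λ : Fin n → ℕ) : Prop :=
  Antitone Λ ∧ (∀ i, Λ i ≤ k) ∧ (∃ i, 0 < Λ i) ∧ (∃ i, Λ i ≠ k)

/-- The infinitesimal induction of a representation `σ` of `G_Λ = Aut(𝔬_Λ)` along
`Λ ↪ k^n`. -/
def infInd (Λ : Fin n → ℕ) {W : Type*} [AddCommGroup W] [Module ℂ W]
    (σ : Representation ℂ (embSub O n k Λ ≃ₗ[oMod O k] embSub O n k Λ) W) :
    Representation ℂ (GLo O n k)
      (Representation.IndV (stab (embSub O n k Λ)).subtype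
        (MonoidHom.comp σ (resHom (embSub O n k Λ)))) :=
  Representation.ind (stab (embSub O n k Λ)).subtype
    (MonoidHom.comp σ (resHom (embSub O n k Λ)))

/-- `π` lies in the infinitesimally induced series. -/
def IsInfInduced {V : Type*} [AddCommGroup V] [Module ℂ V]
    (π : Representation ℂ (GLo O n k) V) : Prop :=
  ∃ Λ : Fin n → ℕ, IsProperPartition n k Λ ∧
    ∃ (W : Type) (_ : AddCommGroup W) (_ : Module ℂ W) (_ : FiniteDimensional ℂ W)
      (σ : Representation ℂ (embSub O n k Λ ≃ₗ[oMod O k] embSub O n k Λ) W),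
      IsSubrepOf π (infInd Λ σ)

/-- An irreducible representation of `GL_n(𝔬_k)` is cuspidal if no twist of it by a linear
character lies in the geometrically or in the infinitesimally induced series. -/
def IsCuspidal {V : Type*} [AddCommGroup V] [Module ℂ V]
    (π : Representation ℂ (GLo O n k) V) : Prop :=
  π.IsIrreducible ∧ ∀ χ : GLo O n k →* ℂˣ,
    ¬ IsGeomInduced (twist χ π) ∧ ¬ IsInfInduced (twist χ π)

end Cuspidal

/-! ### Level two: the congruence kernel, its characters, orbits, strong cuspidality -/

section LevelTwo

variable (O : Type*) [CommRing O] [IsLocalRing O]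

/-- Reduction modulo `𝔭`, from `𝔬_2` to the residue field. -/
def redMap : oMod O 2 →+* IsLocalRing.ResidueField O :=
  Ideal.Quotient.factor (Ideal.pow_le_self two_ne_zero)

/-- The kernel `N_1` of the reduction map from `GL_n(𝔬_2)` to `GL_n` of the residue field. -/
def N1 (n : ℕ) : Subgroup (GLo O n 2) :=
  (Matrix.GeneralLinearGroup.map (n := Fin n) (redMap O)).ker

instance (n : ℕ) : (N1 O n).Normal := MonoidHom.normal_ker _

variable {O} {n : ℕ} {F : Type*} [Field F] [Algebra O F]

/-- A chosen lift to `O` of an element of the residue field. -/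
def liftRes (x : IsLocalRing.ResidueField O) : O :=
  Function.surjInv IsLocalRing.residue_surjective x

/-- A chosen lift to `O` of an element of `𝔬_2`. -/
def liftMod (x : oMod O 2) : O :=
  Function.surjInv (Ideal.Quotient.mk_surjective (I := IsLocalRing.maximalIdeal O ^ 2)) x

theorem residue_liftRes (x : IsLocalRing.ResidueField O) :
    IsLocalRing.residue O (liftRes x) = x :=
  Function.surjInv_eq _ x

theorem mk_liftMod (x : oMod O 2) :
    Ideal.Quotient.mk (IsLocalRing.maximalIdeal O ^ 2) (liftMod x) = x :=
  Function.surjInv_eq _ x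

/-- The character `ψ_β` of `N_1` given by `ψ_β(1 + ϖ x) = ψ(ϖ⁻¹ Tr(β x))`.  It is written here
as `g ↦ ψ(ϖ⁻² Tr(β (g - 1)))` with entrywise lifts of `β` and `g` to `O`; see
`psiBeta_eq` for the usual formula (which shows independence of the lifts). -/
def psiBeta (ψ : AddChar F ℂˣ) (ϖ : O)
    (β : Matrix (Fin n) (Fin n) (IsLocalRing.ResidueField O)) (g : N1 O n) : ℂˣ :=
  ψ ((algebraMap O F ϖ ^ 2)⁻¹ * algebraMap O F
    (Matrix.trace (β.map liftRes *
      (((g : GLo O n 2) : Matrix (Fin n) (Fin n) (oMod O 2)).map liftMod - 1))))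

theorem psiBeta_eq {ψ : AddChar F ℂˣ} (hψ : ∀ x : O, ψ (algebraMap O F x) = 1)
    {ϖ : O} (hϖ : IsLocalRing.maximalIdeal O = Ideal.span {ϖ}) (hϖ0 : algebraMap O F ϖ ≠ 0)
    (β : Matrix (Fin n) (Fin n) (IsLocalRing.ResidueField O)) (g : N1 O n)
    (B X : Matrix (Fin n) (Fin n) O) (hB : B.map (IsLocalRing.residue O) = β)
    (hX : (1 + ϖ • X).map (Ideal.Quotient.mk (IsLocalRing.maximalIdeal O ^ 2)) =
      ((g : GLo O n 2) : Matrix (Fin n) (Fin n) (oMod O 2))) :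
    psiBeta ψ ϖ β g = ψ ((algebraMap O F ϖ)⁻¹ * algebraMap O F (Matrix.trace (B * X))) := by
  have h1 : ∃ C : Matrix (Fin n) (Fin n) O, β.map liftRes = B + ϖ • C := by
    have : ∀ i j, ∃ c, liftRes (β i j) - B i j = ϖ * c := by
      intro i j
      have hm : liftRes (β i j) - B i j ∈ IsLocalRing.maximalIdeal O := by
        rw [← IsLocalRing.residue_eq_zero_iff, map_sub, residue_liftRes, ← hB]
        simp
      obtain ⟨c, hc⟩ := Ideal.mem_span_singleton'.1 (hϖ.le hm)
      exact ⟨c, by rw [← hc, mul_comm]⟩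
    choose C hC using this
    refine ⟨Matrix.of C, ?_⟩
    ext i j
    simp [← hC]
  have h2 : ∃ D : Matrix (Fin n) (Fin n) O,
      ((g : GLo O n 2) : Matrix (Fin n) (Fin n) (oMod O 2)).map liftMod =
        1 + ϖ • X + ϖ ^ 2 • D := by
    have : ∀ i j, ∃ c, liftMod (((g : GLo O n 2) :
        Matrix (Fin n) (Fin n) (oMod O 2)) i j) - (1 + ϖ • X) i j = ϖ ^ 2 * c := by
      intro i j
      have hm : liftMod (((g : GLo O n 2) :
        Matrix (Fin n) (Fin n) (oMod O 2)) i j) - (1 + ϖ • X) i j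
          ∈ IsLocalRing.maximalIdeal O ^ 2 := by
        rw [← Ideal.Quotient.eq, mk_liftMod, ← hX]
        rfl
      have hm' := Ideal.pow_right_mono hϖ.le 2 hm
      rw [Ideal.span_singleton_pow] at hm'
      obtain ⟨c, hc⟩ := Ideal.mem_span_singleton'.1 hm'
      exact ⟨c, by rw [← hc, mul_comm]⟩
    choose C hC using this
    refine ⟨Matrix.of C, ?_⟩
    ext i j
    have := hC i j
    simp only [Matrix.map_apply, Matrix.add_apply, Matrix.smul_apply, Matrix.of_apply,
      smul_eq_mul] at this ⊢
    rw [← this]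
    ring
  obtain ⟨C, hC⟩ := h1
  obtain ⟨D, hD⟩ := h2
  have key : Matrix.trace ((B + ϖ • C) * (1 + ϖ • X + ϖ ^ 2 • D - 1)) =
      ϖ * Matrix.trace (B * X) +
        ϖ ^ 2 * (Matrix.trace (B * D) + Matrix.trace (C * X) + ϖ * Matrix.trace (C * D)) := by
    have : (1 + ϖ • X + ϖ ^ 2 • D - 1 : Matrix (Fin n) (Fin n) O) = ϖ • X + ϖ ^ 2 • D := by
      abel
    rw [this]
    simp only [add_mul, mul_add, Matrix.trace_add, Matrix.trace_smul, smul_mul_assoc,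
      mul_smul_comm, smul_eq_mul]
    ring
  unfold psiBeta
  rw [hC, hD, key, map_add, mul_add, AddChar.map_add_eq_mul]
  have e2 : (algebraMap O F ϖ ^ 2)⁻¹ * algebraMap O F (ϖ ^ 2 *
      (Matrix.trace (B * D) + Matrix.trace (C * X) + ϖ * Matrix.trace (C * D))) =
      algebraMap O F (Matrix.trace (B * D) + Matrix.trace (C * X) + ϖ * Matrix.trace (C * D)) := by
    rw [map_mul (algebraMap O F) (ϖ ^ 2), map_pow]
    field_simp
  rw [e2, hψ, mul_one]
  congr 1
  rw [map_mul]
  field_simp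

/-- The stabilizer `G(ψ_β)` of `ψ_β` under conjugation. -/
def stabPsi (ψ : AddChar F ℂˣ) (ϖ : O)
    (β : Matrix (Fin n) (Fin n) (IsLocalRing.ResidueField O)) : Subgroup (GLo O n 2) where
  carrier := {g | ∀ x : N1 O n, psiBeta ψ ϖ β (MulAut.conjNormal g x) = psiBeta ψ ϖ β x}
  one_mem' := fun x => by simp
  mul_mem' {g h} hg hh := fun x => by
    rw [map_mul, MulAut.mul_apply, hg, hh]
  inv_mem' {g} hg := fun x => by
    rw [← hg, ← MulAut.mul_apply, ← map_mul, mul_inv_cancel, map_one, MulAut.one_apply]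

/-- The restriction to `N_1` of a representation `ρ` of a subgroup `H` of `GL_n(𝔬_2)` (used for
subgroups containing `N_1`) contains `ψ_β`. -/
def ContainsPsi (ψ : AddChar F ℂˣ) (ϖ : O)
    (β : Matrix (Fin n) (Fin n) (IsLocalRing.ResidueField O)) {H : Subgroup (GLo O n 2)}
    {W : Type*} [AddCommGroup W] [Module ℂ W] (ρ : Representation ℂ H W) : Prop :=
  ∃ w : W, w ≠ 0 ∧ ∀ (x : H) (hx : (x : GLo O n 2) ∈ N1 O n),
    ρ x w = (psiBeta ψ ϖ β ⟨x, hx⟩ : ℂ) • w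

/-- The orbit `Ω_1(π)` of a representation `π` of `GL_n(𝔬_2)`: the set of all `β` such that the
restriction of `π` to `N_1` contains `ψ_β`. -/
def orbit (ψ : AddChar F ℂˣ) (ϖ : O) {V : Type*} [AddCommGroup V] [Module ℂ V]
    (π : Representation ℂ (GLo O n 2) V) :
    Set (Matrix (Fin n) (Fin n) (IsLocalRing.ResidueField O)) :=
  {β | ∃ v : V, v ≠ 0 ∧ ∀ x : N1 O n, π x v = (psiBeta ψ ϖ β x : ℂ) • v}

/-- The matrix `M` leaves no non-trivial proper subspace invariant. -/
def IsIrreducibleMatrix {κ : Type*} [Field κ] (M : Matrix (Fin n) (Fin n) κ) : Prop :=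
  ∀ p : Submodule κ (Fin n → κ), (∀ v ∈ p, M.mulVec v ∈ p) → p = ⊥ ∨ p = ⊤

/-- An irreducible representation of `GL_n(𝔬_2)` is strongly cuspidal if its orbit is
irreducible. -/
def IsStronglyCuspidal (ψ : AddChar F ℂˣ) (ϖ : O) {V : Type*} [AddCommGroup V] [Module ℂ V]
    (π : Representation ℂ (GLo O n 2) V) : Prop :=
  π.IsIrreducible ∧ ∀ β ∈ orbit ψ ϖ π, IsIrreducibleMatrix β

end LevelTwo

/-- The `4 × 4` matrix with block form `(η, 1; 0, η)`, where an element `η` of a quadratic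
extension `E / κ` is viewed as a `2 × 2` matrix over `κ` by means of the basis `b`. -/
def betaOne {κ E : Type*} [Field κ] [Field E] [Algebra κ E] (b : Module.Basis (Fin 2) κ E)
    (η : E) : Matrix (Fin 4) (Fin 4) κ :=
  Matrix.reindex finSumFinEquiv finSumFinEquiv
    (Matrix.fromBlocks (Algebra.leftMulMatrix b η) 1 0 (Algebra.leftMulMatrix b η))

end CuspidalGL

end

/-! The argument is Clifford theory for the normal subgroup `N1`, made simple by regularity of the
matrix `(η, 1; 0, η)`. The stabilizer of `ψ_β` is the preimage of the centralizer of `β` over the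
residue field (`mem_stabPsi_iff`). For this `β` the centralizer consists of the matrices `(x, y; 0,
x)` with `x, y` in the field generated by `η`, because `η` is separable (`exists_eq_centMat`). These
matrices commute, and so do suitable lifts of them; hence commutators of the stabilizer lie in `N1`
and `ψ_β` is trivial on them (`trivialOnCommutators_jordanMat`). Everything above `ψ_β` is then a
linear character `χ` extending `ψ_β`, and `Ind χ` is irreducible and determines `χ`, since nothing
outside the stabilizer fixes `ψ_β` (`exists_equiv_ind`, `extends_unique`).

For cuspidality, Frobenius reciprocity turns membership in an induced series into the existence of
nonzero fixed vectors under a unipotent group. Twisting does no harm, because linear characters of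
`GL_4` are trivial on elementary matrices. In `Ind χ` a vector fixed by `U` and supported at `g`
forces `χ` to be trivial on the part of `g U g⁻¹` inside the stabilizer. The part in `N1` alone
already makes a block of `g⁻¹ β g` vanish (`conj_entry_eq_zero`), so `β` has an invariant subspace
of the corresponding dimension. The characteristic polynomial of `β` is the square of an irreducible
quadratic, so there is no invariant line or hyperplane. This excludes the parabolics of types (1,3)
and (3,1) and every infinitesimal induction. The only invariant plane is the standard one
(`eq_zero_of_invariant`), so for type (2,2) the element `g` is block triangular modulo `N1`, and `χ`
must be trivial on the stabilizer's intersection with `U_{2,2}` (`isCuspidal_ind`). Conversely, such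
triviality yields a `U_{2,2}`-fixed vector (`not_isCuspidal_ind`).

A cuspidal representation exists because `1 + E_{13} + E_{24}` lies in that intersection but not in
`N1`, and extensions of `ψ_β` can be made nontrivial at any element outside `N1` (`exists_extends`).
It is not strongly cuspidal, as `β` preserves the standard plane. -/

noncomputable section

namespace CuspidalGL

/-! ### Induced representations of finite groups -/

section Induction

open Representation

variable {G : Type*} [Group G] {H : Subgroup G} {W : Type*} [AddCommGroup W] [Module ℂ W]
  (ρ : Representation ℂ H W) {V : Type*} [AddCommGroup V] [Module ℂ V]
  (τ : Representation ℂ G V)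

/-- `IndV` is the space of `H`-coinvariants of `ℂ[G] ⊗ W`, so its vectors are supported on cosets
`Hg`, and `G` acts by right translation through inverses. -/
theorem indMk_mul (h : H) (g : G) (a : W) :
    IndV.mk H.subtype ρ (h * g) (ρ h a) = IndV.mk H.subtype ρ g a := by
  have := Coinvariants.mk_self_apply
    (Representation.tprod ((leftRegular ℂ G).comp H.subtype) ρ) h
    (TensorProduct.mk ℂ _ _ (MonoidAlgebra.single g 1) a)
  simpa using this

/-- A linear map out of an induced representation. -/
def indDesc (f : G → W →ₗ[ℂ] V) (hf : ∀ (h : H) (g : G) (a : W), f (h * g) (ρ h a) = f g a) :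
    IndV H.subtype ρ →ₗ[ℂ] V :=
  Coinvariants.lift _
    (TensorProduct.lift <| (Finsupp.lift _ _ _ f) ∘ₗ
      (MonoidAlgebra.coeffLinearEquiv ℂ).toLinearMap)
    fun h ↦ by
      ext g x
      simp [hf]

theorem indDesc_mk (f : G → W →ₗ[ℂ] V)
    (hf : ∀ (h : H) (g : G) (a : W), f (h * g) (ρ h a) = f g a) (g : G) (a : W) :
    indDesc ρ f hf (IndV.mk H.subtype ρ g a) = f g a := by
  simp [indDesc]

theorem indV_induction {p : IndV H.subtype ρ → Prop} (x : IndV H.subtype ρ)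
    (h0 : p 0) (hadd : ∀ x y, p x → p y → p (x + y))
    (hmk : ∀ g a, p (IndV.mk H.subtype ρ g a)) : p x := by
  induction x using Coinvariants.induction_on with
  | h v =>
    induction v using TensorProduct.induction_on with
    | zero => simpa using h0
    | add x y hx hy => rw [map_add]; exact hadd _ _ hx hy
    | tmul s a =>
      induction s using MonoidAlgebra.induction_linear with
      | zero => simpa using h0
      | add x y hx hy => rw [TensorProduct.add_tmul, map_add]; exact hadd _ _ hx hy
      | single g c =>
        have : (MonoidAlgebra.single g c : MonoidAlgebra ℂ G) = c • MonoidAlgebra.single g 1 := by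
          simp
        rw [this, TensorProduct.smul_tmul]
        exact hmk g (c • a)

variable {ρ τ} in
/-- Frobenius reciprocity: the map from an induced representation. -/
def indLift (f : W →ₗ[ℂ] V) (hf : ∀ (h : H) (a : W), f (ρ h a) = τ h (f a)) :
    IntertwiningMap (ind H.subtype ρ) τ where
  toLinearMap := indDesc ρ (fun g ↦ τ g⁻¹ ∘ₗ f) (by intro h g a; simp [hf, ← Module.End.mul_apply,
    ← map_mul])
  isIntertwining' g := by
    refine IndV.hom_ext _ _ fun g' ↦ LinearMap.ext fun a ↦ ?_
    simp only [LinearMap.comp_apply]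
    erw [ind_mk, indDesc_mk, indDesc_mk]
    simp [← Module.End.mul_apply, ← map_mul]

theorem indLift_mk (f : W →ₗ[ℂ] V) (hf : ∀ (h : H) (a : W), f (ρ h a) = τ h (f a)) (g : G)
    (a : W) : indLift (τ := τ) f hf (IndV.mk H.subtype ρ g a) = τ g⁻¹ (f a) :=
  indDesc_mk ρ _ (by intro h g a; simp [hf, ← Module.End.mul_apply, ← map_mul]) g a

open Classical in
/-- Evaluation at the identity on an induced representation. -/
def indEv : IndV H.subtype ρ →ₗ[ℂ] W :=
  indDesc ρ (fun g ↦ if hg : g ∈ H then ρ (⟨g, hg⟩⁻¹ : H) else 0) (by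
    intro h g a
    by_cases hg : g ∈ H
    · have : (h : G) * g ∈ H := H.mul_mem h.2 hg
      simp only [hg, this, dif_pos]
      rw [← Module.End.mul_apply, ← map_mul]
      congr 2
      ext
      simp
    · have : ¬ (h : G) * g ∈ H := fun hh ↦ hg ((H.mul_mem_cancel_left h.2).1 hh)
      simp [hg, this])

theorem indEv_mk_of_mem {g : G} (hg : g ∈ H) (a : W) :
    indEv ρ (IndV.mk H.subtype ρ g a) = ρ (⟨g, hg⟩⁻¹ : H) a := by
  rw [indEv, indDesc_mk, dif_pos hg]

theorem indEv_mk_of_notMem {g : G} (hg : g ∉ H) (a : W) :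
    indEv ρ (IndV.mk H.subtype ρ g a) = 0 := by
  rw [indEv, indDesc_mk, dif_neg hg, LinearMap.zero_apply]

theorem indEv_ind (h : H) (x : IndV H.subtype ρ) :
    indEv ρ (ind H.subtype ρ h x) = ρ h (indEv ρ x) := by
  induction x using indV_induction with
  | h0 => simp only [map_zero]
  | hadd x y hx hy => simp only [map_add, hx, hy]
  | hmk g a =>
    rw [ind_mk]
    by_cases hg : g ∈ H
    · have : g * (h : G)⁻¹ ∈ H := H.mul_mem hg (H.inv_mem h.2)
      rw [indEv_mk_of_mem _ hg, indEv_mk_of_mem _ this, ← Module.End.mul_apply, ← map_mul]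
      congr 2
      ext
      simp
    · have : g * (h : G)⁻¹ ∉ H := fun hh ↦ hg ((H.mul_mem_cancel_right (H.inv_mem h.2)).1 hh)
      rw [indEv_mk_of_notMem _ hg, indEv_mk_of_notMem _ this, map_zero]

theorem ind_mk_one (g : G) (a : W) :
    ind H.subtype ρ g (IndV.mk H.subtype ρ 1 a) = IndV.mk H.subtype ρ g⁻¹ a := by
  rw [ind_mk, one_mul]

theorem ind_mk_one_of_mem (h : H) (a : W) :
    ind H.subtype ρ h (IndV.mk H.subtype ρ 1 a) = IndV.mk H.subtype ρ 1 (ρ h a) := by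
  rw [ind_mk_one, ← indMk_mul ρ h, mul_inv_cancel]

-- Reconstruction of a vector from the values of its translates at the identity. On a generator
-- supported at `g`, exactly the elements of `Hg` contribute, each returning the generator itself,
-- whence the factor `|H|`.
open Classical in
theorem sum_mk_indEv [Fintype G] (x : IndV H.subtype ρ) :
    ∑ g : G, IndV.mk H.subtype ρ g (indEv ρ (ind H.subtype ρ g x)) = (Nat.card H : ℂ) • x := by
  induction x using indV_induction with
  | h0 => simp only [map_zero, Finset.sum_const_zero, smul_zero]
  | hadd x y hx hy => simp only [map_add, Finset.sum_add_distrib, hx, hy, smul_add]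
  | hmk g a =>
    rw [← Equiv.sum_comp (Equiv.mulRight g)]
    have key : ∀ h : G, IndV.mk H.subtype ρ (h * g)
        (indEv ρ (ind H.subtype ρ (h * g) (IndV.mk H.subtype ρ g a))) =
        if h ∈ H then IndV.mk H.subtype ρ g a else 0 := by
      intro h
      rw [ind_mk, mul_inv_rev, mul_inv_cancel_left]
      by_cases hh : h ∈ H
      · rw [indEv_mk_of_mem ρ (H.inv_mem hh), if_pos hh]
        rw [← indMk_mul ρ ⟨h, hh⟩ g a]
        congr 2
        exact congrArg ρ (by ext; simp)
      · rw [indEv_mk_of_notMem ρ (fun h' ↦ hh (by simpa using h')), if_neg hh, map_zero]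
    simp only [Equiv.coe_mulRight, key]
    rw [← Finset.sum_filter, Finset.sum_const, ← Nat.cast_smul_eq_nsmul ℂ]
    congr 2
    rw [Nat.card_eq_fintype_card, Fintype.card_subtype]

theorem eq_zero_of_indEv [Finite G] (x : IndV H.subtype ρ)
    (hx : ∀ g, indEv ρ (ind H.subtype ρ g x) = 0) : x = 0 := by
  have := Fintype.ofFinite G
  have h := sum_mk_indEv ρ x
  simp only [hx, map_zero, Finset.sum_const_zero] at h
  exact (smul_eq_zero.1 h.symm).resolve_left (Nat.cast_ne_zero.2 Nat.card_pos.ne')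

/-- Frobenius reciprocity: the map into an induced representation. -/
def indColift [Fintype G] (f : V →ₗ[ℂ] W) :
    IntertwiningMap τ (ind H.subtype ρ) where
  toLinearMap := ∑ g : G, IndV.mk H.subtype ρ g ∘ₗ f ∘ₗ τ g
  isIntertwining' k := by
    refine LinearMap.ext fun v ↦ ?_
    simp only [LinearMap.comp_apply, LinearMap.sum_apply, map_sum]
    rw [← Equiv.sum_comp (Equiv.mulRight k) fun g ↦ ind H.subtype ρ k _]
    refine Finset.sum_congr rfl fun g _ ↦ ?_
    erw [ind_mk]
    simp

-- Only the terms of the averaging sum indexed by `H` survive evaluation, and equivariance makes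
-- each of them equal to `f v`.
open Classical in
theorem indEv_indColift [Fintype G] (f : V →ₗ[ℂ] W)
    (hf : ∀ (h : H) (v : V), f (τ h v) = ρ h (f v)) (v : V) :
    indEv ρ (indColift ρ τ f v) = (Nat.card H : ℂ) • f v := by
  have key : ∀ h : G, indEv ρ (IndV.mk H.subtype ρ h (f (τ h v))) = if h ∈ H then f v else 0 := by
    intro h
    by_cases hh : h ∈ H
    · rw [indEv_mk_of_mem ρ hh, if_pos hh, hf ⟨h, hh⟩, ← Module.End.mul_apply, ← map_mul]
      simp
    · rw [indEv_mk_of_notMem ρ hh, if_neg hh]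
  have : indColift ρ τ f v = ∑ g : G, IndV.mk H.subtype ρ g (f (τ g v)) := by
    change (∑ g : G, IndV.mk H.subtype ρ g ∘ₗ f ∘ₗ τ g) v = _
    rw [LinearMap.sum_apply]
    rfl
  rw [this, map_sum]
  simp only [key]
  rw [← Finset.sum_filter, Finset.sum_const, ← Nat.cast_smul_eq_nsmul ℂ]
  congr 2
  rw [Nat.card_eq_fintype_card, Fintype.card_subtype]

/-- An irreducible representation with a nonzero `H`-map to `ρ` embeds in the representation
induced from `ρ`. -/
theorem isSubrepOf_ind [Finite G] (hτ : τ.IsIrreducible) (f : V →ₗ[ℂ] W)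
    (hf : ∀ (h : H) (v : V), f (τ h v) = ρ h (f v)) (hf0 : f ≠ 0) :
    IsSubrepOf τ (ind H.subtype ρ) := by
  have := Fintype.ofFinite G
  refine ⟨indColift ρ τ f, (IsIrreducible.injective_or_eq_zero _).resolve_right fun h0 ↦ ?_⟩
  refine hf0 (LinearMap.ext fun v ↦ ?_)
  have h := indEv_indColift ρ τ f hf v
  rw [h0, IntertwiningMap.coe_zero, Pi.zero_apply, map_zero] at h
  exact (smul_eq_zero.1 h.symm).resolve_left (Nat.cast_ne_zero.2 Nat.card_pos.ne')

/-- A nonzero subrepresentation of an induced representation has nonzero vectors fixed by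
any subgroup on which the inducing representation is trivial. -/
theorem exists_fixed_of_isSubrepOf_ind [Finite G] [Nontrivial V]
    (h : IsSubrepOf τ (ind H.subtype ρ)) (K : Subgroup G) (hK : ∀ k ∈ K, ∃ hk : k ∈ H, ρ ⟨k, hk⟩ = 1) :
    ∃ v : V, v ≠ 0 ∧ ∀ k ∈ K, τ k v = v := by
  classical
  have := Fintype.ofFinite G
  obtain ⟨F, hF⟩ := h
  obtain ⟨v₀, hv₀⟩ := exists_ne (0 : V)
  have hF0 : F v₀ ≠ 0 := fun h ↦ hv₀ (hF (by rw [h]; exact (map_zero F.toLinearMap).symm))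
  obtain ⟨g, hg⟩ : ∃ g, indEv ρ (ind H.subtype ρ g (F v₀)) ≠ 0 := by
    by_contra! hcon
    exact hF0 (eq_zero_of_indEv ρ _ hcon)
  -- Averaging over `K` produces a fixed vector. As `ρ` is trivial on `K`, the averaging multiplies
  -- the value at the identity by `|K|`, so it cannot vanish.
  refine ⟨∑ k : K, τ k (τ g v₀), fun h0 ↦ ?_, fun k hk ↦ ?_⟩
  · have h1 : ∀ k : K, indEv ρ (F.toLinearMap (τ k (τ g v₀))) =
        indEv ρ (ind H.subtype ρ g (F v₀)) := by
      intro k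
      obtain ⟨hk, hk'⟩ := hK k k.2
      rw [IntertwiningMap.toLinearMap_apply, IntertwiningMap.isIntertwining,
        IntertwiningMap.isIntertwining]
      have := indEv_ind ρ ⟨k, hk⟩ (ind H.subtype ρ g (F v₀))
      rw [hk'] at this
      exact this
    have h2 := congrArg (fun v ↦ indEv ρ (F.toLinearMap v)) h0
    simp only [map_sum, h1, map_zero, Finset.sum_const, ← Nat.cast_smul_eq_nsmul ℂ] at h2
    refine hg ((smul_eq_zero.1 h2).resolve_left (Nat.cast_ne_zero.2 ?_))
    rw [Finset.card_univ]
    exact Fintype.card_ne_zero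
  · rw [map_sum, ← Equiv.sum_comp (Equiv.mulLeft (⟨k, hk⟩ : K)) (fun x : K ↦ τ x (τ g v₀))]
    refine Finset.sum_congr rfl fun x _ ↦ ?_
    rw [← Module.End.mul_apply, ← map_mul]
    rfl

/-- Induction respects isomorphism. -/
theorem nonempty_ind_equiv {W' : Type*} [AddCommGroup W'] [Module ℂ W']
    {ρ' : Representation ℂ H W'} (e : ρ.Equiv ρ') :
    Nonempty ((ind H.subtype ρ).Equiv (ind H.subtype ρ')) := by
  have hs : ∀ (h : H) (a : W'), e.symm (ρ' h a) = ρ h (e.symm a) := fun h a ↦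
    IntertwiningMap.isIntertwining _ _ e.symm.toIntertwiningMap h a
  have he : ∀ (h : H) (a : W), e (ρ h a) = ρ' h (e a) := fun h a ↦
    IntertwiningMap.isIntertwining _ _ e.toIntertwiningMap h a
  let f : IntertwiningMap (ind H.subtype ρ) (ind H.subtype ρ') :=
    indLift (IndV.mk H.subtype ρ' 1 ∘ₗ e.toIntertwiningMap.toLinearMap) fun h a ↦ by
      change IndV.mk H.subtype ρ' 1 (e (ρ h a)) = ind H.subtype ρ' h (IndV.mk H.subtype ρ' 1 (e a))
      rw [he, ind_mk_one_of_mem]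
  let g : IntertwiningMap (ind H.subtype ρ') (ind H.subtype ρ) :=
    indLift (IndV.mk H.subtype ρ 1 ∘ₗ e.symm.toIntertwiningMap.toLinearMap) fun h a ↦ by
      change IndV.mk H.subtype ρ 1 (e.symm (ρ' h a)) =
        ind H.subtype ρ h (IndV.mk H.subtype ρ 1 (e.symm a))
      rw [hs, ind_mk_one_of_mem]
  have hf : ∀ x a, f (IndV.mk H.subtype ρ x a) = IndV.mk H.subtype ρ' x (e a) := fun x a ↦ by
    rw [indLift_mk]
    change ind H.subtype ρ' x⁻¹ (IndV.mk H.subtype ρ' 1 (e a)) = _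
    rw [ind_mk_one, inv_inv]
  have hg : ∀ x a, g (IndV.mk H.subtype ρ' x a) = IndV.mk H.subtype ρ x (e.symm a) := fun x a ↦ by
    rw [indLift_mk]
    change ind H.subtype ρ x⁻¹ (IndV.mk H.subtype ρ 1 (e.symm a)) = _
    rw [ind_mk_one, inv_inv]
  refine ⟨.mk (LinearEquiv.ofLinearMap f.toLinearMap g.toLinearMap ?_ ?_) f.isIntertwining'⟩
  · refine IndV.hom_ext _ _ fun x ↦ LinearMap.ext fun a ↦ ?_
    change f (g (IndV.mk H.subtype ρ' x a)) = IndV.mk H.subtype ρ' x a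
    rw [hg, hf]
    congr 1
    exact e.toLinearEquiv.apply_symm_apply a
  · refine IndV.hom_ext _ _ fun x ↦ LinearMap.ext fun a ↦ ?_
    change g (f (IndV.mk H.subtype ρ x a)) = IndV.mk H.subtype ρ x a
    rw [hf, hg]
    congr 1
    exact e.toLinearEquiv.symm_apply_apply a

end Induction

/-! ### Irreducibility, isomorphisms and twists -/

section Irreducible

open Representation

variable {G : Type*} [Group G] {V : Type*} [AddCommGroup V] [Module ℂ V]
  {τ : Representation ℂ G V} {W : Type*} [AddCommGroup W] [Module ℂ W]
  {σ : Representation ℂ G W}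

theorem nontrivial_of_isIrreducible (hτ : τ.IsIrreducible) : Nontrivial V := by
  by_contra h
  rw [not_nontrivial_iff_subsingleton] at h
  refine bot_ne_top (α := Subrepresentation τ) (Subrepresentation.toSubmodule_injective ?_)
  exact Subsingleton.elim _ _

theorem eq_top_of_isIrreducible (hτ : τ.IsIrreducible) (S : Submodule ℂ V)
    (hS : ∀ g, ∀ v ∈ S, τ g v ∈ S) {v : V} (hv : v ∈ S) (hv0 : v ≠ 0) : S = ⊤ := by
  rcases IsSimpleOrder.eq_bot_or_eq_top (⟨S, fun g v hv ↦ hS g v hv⟩ : Subrepresentation τ)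
    with h | h
  · have : S = ⊥ := congrArg Subrepresentation.toSubmodule h
    rw [this, Submodule.mem_bot] at hv
    exact absurd hv hv0
  · exact congrArg Subrepresentation.toSubmodule h

theorem isIrreducible_of_forall [Nontrivial V]
    (h : ∀ S : Submodule ℂ V, (∀ g, ∀ v ∈ S, τ g v ∈ S) → ∀ v ∈ S, v ≠ 0 → S = ⊤) :
    τ.IsIrreducible where
  exists_pair_ne := by
    refine ⟨⊥, ⊤, fun h ↦ ?_⟩
    exact bot_ne_top (α := Submodule ℂ V) (congrArg Subrepresentation.toSubmodule h)
  eq_bot_or_eq_top S := by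
    by_cases hS : S.toSubmodule = ⊥
    · exact .inl (Subrepresentation.toSubmodule_injective hS)
    · obtain ⟨v, hv, hv0⟩ := Submodule.exists_mem_ne_zero_of_ne_bot hS
      exact .inr (Subrepresentation.toSubmodule_injective
        (h S.toSubmodule (fun g v hv ↦ S.apply_mem_toSubmodule g hv) v hv hv0))

theorem equiv_apply (e : τ.Equiv σ) (g : G) (v : V) : e (τ g v) = σ g (e v) :=
  IntertwiningMap.isIntertwining _ _ e.toIntertwiningMap g v

theorem equiv_map_smul (e : τ.Equiv σ) (c : ℂ) (v : V) : e (c • v) = c • e v :=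
  e.toLinearEquiv.map_smul c v

theorem equiv_ne_zero (e : τ.Equiv σ) {v : V} (hv : v ≠ 0) : e v ≠ 0 :=
  fun h ↦ hv (e.toLinearEquiv.map_eq_zero_iff.1 h)

theorem isIrreducible_of_equiv (e : τ.Equiv σ) (hτ : τ.IsIrreducible) : σ.IsIrreducible := by
  have := nontrivial_of_isIrreducible hτ
  obtain ⟨v, hv⟩ := exists_ne (0 : V)
  have : Nontrivial W := ⟨e v, 0, equiv_ne_zero e hv⟩
  refine isIrreducible_of_forall fun S hS w hw hw0 ↦ ?_
  have h := eq_top_of_isIrreducible hτ (S.comap e.toLinearEquiv.toLinearMap)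
    (fun g v hv ↦ by
      change e (τ g v) ∈ S
      rw [equiv_apply]
      exact hS g _ hv) (v := e.symm w) (by
      change e (e.symm w) ∈ S
      rwa [show e (e.symm w) = w from e.toLinearEquiv.apply_symm_apply w])
      (equiv_ne_zero e.symm hw0)
  rw [eq_top_iff]
  intro x _
  have hx : e.symm x ∈ S.comap e.toLinearEquiv.toLinearMap := by rw [h]; trivial
  rwa [Submodule.mem_comap, show e.toLinearEquiv.toLinearMap (e.symm x) = x from
    e.toLinearEquiv.apply_symm_apply x] at hx

theorem charRep_apply (χ : G →* ℂˣ) (g : G) (c : ℂ) : charRep χ g c = χ g * c := rfl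

theorem twist_apply (χ : G →* ℂˣ) (g : G) (v : V) : twist χ τ g v = (χ g : ℂ) • τ g v := rfl

theorem charRep_isIrreducible (χ : G →* ℂˣ) : (charRep χ).IsIrreducible := by
  refine isIrreducible_of_forall fun S _ v hv hv0 ↦ ?_
  exact (Ideal.eq_top_iff_one S).2 (by simpa [hv0] using S.smul_mem v⁻¹ hv)

/-- Twisting an isomorphism. -/
def twistEquiv (χ : G →* ℂˣ) (e : τ.Equiv σ) : (twist χ τ).Equiv (twist χ σ) :=
  .mk e.toLinearEquiv fun g ↦ LinearMap.ext fun v ↦ by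
    change e (twist χ τ g v) = twist χ σ g (e v)
    rw [twist_apply, twist_apply, equiv_map_smul, equiv_apply]

theorem isSubrepOf_of_equiv (e : τ.Equiv σ) {X : Type*} [AddCommGroup X] [Module ℂ X]
    {ξ : Representation ℂ G X} (h : IsSubrepOf σ ξ) : IsSubrepOf τ ξ := by
  obtain ⟨f, hf⟩ := h
  exact ⟨f.comp e.toIntertwiningMap, hf.comp e.toLinearEquiv.injective⟩

theorem twist_one : twist 1 τ = τ := by
  ext g v
  simp [twist_apply]

/-- An irreducible representation with an eigenvector for a linear character is that character. -/
theorem nonempty_equiv_charRep (hτ : τ.IsIrreducible) (χ : G →* ℂˣ) {w : V} (hw0 : w ≠ 0)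
    (hw : ∀ g, τ g w = (χ g : ℂ) • w) : Nonempty (τ.Equiv (charRep χ)) := by
  have htop : ℂ ∙ w = ⊤ := eq_top_of_isIrreducible hτ _ (fun g v hv ↦ by
    obtain ⟨c, rfl⟩ := Submodule.mem_span_singleton.1 hv
    rw [map_smul, hw]
    exact Submodule.smul_mem _ _ (Submodule.smul_mem _ _ (Submodule.mem_span_singleton_self w)))
    (Submodule.mem_span_singleton_self w) hw0
  let e : (charRep χ).Equiv τ := .mk (LinearEquiv.ofBijective (LinearMap.toSpanSingleton ℂ V w)
      ⟨fun a b hab ↦ smul_left_injective ℂ hw0 hab, fun v ↦ by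
        have : v ∈ ℂ ∙ w := by rw [htop]; trivial
        exact Submodule.mem_span_singleton.1 this⟩)
    fun g ↦ LinearMap.ext fun c ↦ by
      change (charRep χ g c) • w = τ g (c • w)
      rw [charRep_apply, map_smul, hw, smul_smul, mul_comm]
  exact ⟨e.symm⟩

end Irreducible

/-! ### Eigenvectors and extension of characters when commutators act trivially -/

section Eigenvectors

variable {H : Type*} [Group H] [Finite H]

instance : Finite (Abelianization H →* ℂˣ) :=
  Nat.finite_of_card_ne_zero (by
    rw [CommGroup.card_monoidHom_of_hasEnoughRootsOfUnity]
    exact Nat.card_pos.ne')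

/-- Some character `φ` of the abelianization is nontrivial at `h`. Multiplication by `φ` permutes
the characters, so the sum equals `φ(h)` times itself. -/
theorem sum_character_eq_zero [Fintype (Abelianization H →* ℂˣ)] {h : H}
    (hh : h ∉ commutator H) :
    ∑ θ : Abelianization H →* ℂˣ, (θ (Abelianization.of h) : ℂ) = 0 := by
  have h1 : Abelianization.of h ≠ 1 := by
    rwa [Ne, ← MonoidHom.mem_ker, Abelianization.ker_of]
  obtain ⟨φ, hφ⟩ := CommGroup.exists_apply_ne_one_of_hasEnoughRootsOfUnity
    (Abelianization H) ℂ h1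
  have h2 : (φ (Abelianization.of h) : ℂ) *
      ∑ θ : Abelianization H →* ℂˣ, (θ (Abelianization.of h) : ℂ) =
      ∑ θ : Abelianization H →* ℂˣ, (θ (Abelianization.of h) : ℂ) := by
    rw [Finset.mul_sum]
    refine Fintype.sum_equiv (Equiv.mulLeft φ) _ _ fun θ ↦ ?_
    simp
  have h3 : ((φ (Abelianization.of h) : ℂ) - 1) *
      ∑ θ : Abelianization H →* ℂˣ, (θ (Abelianization.of h) : ℂ) = 0 := by
    rw [sub_mul, h2, one_mul, sub_self]
  refine (mul_eq_zero.1 h3).resolve_left (sub_ne_zero.2 ?_)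
  exact fun h ↦ hφ (Units.ext h)

variable {V : Type*} [AddCommGroup V] [Module ℂ V] (τ : Representation ℂ H V)

/-- An invariant subspace on which a finite group acts commutatively is spanned by
eigenvectors. -/
theorem le_span_eigenvectors (S : Submodule ℂ V) (hS : ∀ h, ∀ v ∈ S, τ h v ∈ S)
    (hcomm : ∀ h k, ∀ v ∈ S, τ h (τ k v) = τ k (τ h v)) :
    S ≤ Submodule.span ℂ {v | v ∈ S ∧ ∃ χ : H →* ℂˣ, ∀ h, τ h v = (χ h : ℂ) • v} := by
  classical
  have := Fintype.ofFinite H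
  have := Fintype.ofFinite (Abelianization H →* ℂˣ)
  -- The pointwise stabilizer of `S` is a subgroup containing all commutators, so the action on `S`
  -- factors through the abelianization.
  have hker : ∀ h ∈ commutator H, ∀ v ∈ S, τ h v = v := by
    let K : Subgroup H :=
      { carrier := {h | ∀ v ∈ S, τ h v = v}
        one_mem' := fun v _ ↦ by simp
        mul_mem' := fun {a b} ha hb v hv ↦ by
          rw [map_mul, Module.End.mul_apply, hb v hv, ha v hv]
        inv_mem' := fun {a} ha v hv ↦ by
          conv_lhs => rw [← ha v hv]
          simp }
    have hK : commutator H ≤ K := by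
      rw [commutator_eq_closure, Subgroup.closure_le]
      rintro _ ⟨a, b, rfl⟩ v hv
      rw [commutatorElement_def, map_mul, map_mul, map_mul]
      simp only [Module.End.mul_apply]
      rw [hcomm a⁻¹ b⁻¹ v hv]
      simp only [← Module.End.mul_apply, ← map_mul]
      simp
    exact fun h hh ↦ hK hh
  intro v hv
  -- Up to a scalar, `x θ` is the projection of `v` to the eigenspace of `θ⁻¹`.
  let x : (Abelianization H →* ℂˣ) → V := fun θ ↦
    ∑ h : H, (θ (Abelianization.of h) : ℂ) • τ h v
  have hx : ∀ θ, x θ ∈ S := fun θ ↦ Submodule.sum_mem _ fun h _ ↦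
    S.smul_mem _ (hS _ _ hv)
  have hx' : ∀ θ k, τ k (x θ) = (((θ.comp Abelianization.of)⁻¹ k : ℂˣ) : ℂ) • x θ := by
    intro θ k
    simp only [x, map_sum, Finset.smul_sum, smul_smul, map_smul]
    refine Fintype.sum_equiv (Equiv.mulLeft k) _ _ fun h ↦ ?_
    rw [← Module.End.mul_apply, ← map_mul]
    simp
  -- By orthogonality only `h` in the commutator subgroup contribute to the double sum. Each of them
  -- fixes `v` and is counted once per character.
  have hsum : ∑ θ, x θ = ((Nat.card (Abelianization H →* ℂˣ) * Nat.card (commutator H) : ℕ) : ℂ)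
      • v := by
    simp only [x]
    rw [Finset.sum_comm]
    simp only [← Finset.sum_smul]
    have : ∀ h : H, (∑ θ : Abelianization H →* ℂˣ, (θ (Abelianization.of h) : ℂ)) • τ h v =
        if h ∈ commutator H then (Nat.card (Abelianization H →* ℂˣ) : ℂ) • v else 0 := by
      intro h
      split_ifs with hh
      · have h1 : Abelianization.of h = 1 := by
          rwa [← MonoidHom.mem_ker, Abelianization.ker_of]
        rw [hker h hh v hv, h1]
        simp [Nat.card_eq_fintype_card]
      · rw [sum_character_eq_zero hh, zero_smul]
    simp only [this]
    rw [← Finset.sum_filter, Finset.sum_const, ← Nat.cast_smul_eq_nsmul ℂ, smul_smul]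
    congr 1
    rw [Nat.cast_mul, mul_comm]
    congr 2
    rw [Nat.card_eq_fintype_card, Fintype.card_subtype]
  have hne : ((Nat.card (Abelianization H →* ℂˣ) * Nat.card (commutator H) : ℕ) : ℂ) ≠ 0 :=
    Nat.cast_ne_zero.2 (Nat.mul_pos Nat.card_pos Nat.card_pos).ne'
  rw [← inv_smul_smul₀ hne v, ← hsum]
  exact Submodule.smul_mem _ _ (Submodule.sum_mem _ fun θ _ ↦
    Submodule.subset_span ⟨hx θ, _, hx' θ⟩)

theorem exists_eigenvector (S : Submodule ℂ V) (hS : ∀ h, ∀ v ∈ S, τ h v ∈ S)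
    (hcomm : ∀ h k, ∀ v ∈ S, τ h (τ k v) = τ k (τ h v)) {v : V} (hv : v ∈ S) (hv0 : v ≠ 0) :
    ∃ w ∈ S, w ≠ 0 ∧ ∃ χ : H →* ℂˣ, ∀ h, τ h w = (χ h : ℂ) • w := by
  by_contra! hcon
  refine hv0 ((Submodule.mem_bot ℂ).1 (Submodule.span_le.2 ?_
    (le_span_eigenvectors τ S hS hcomm hv)))
  rintro w ⟨hw, χ, hχ⟩
  by_contra hw0
  obtain ⟨h, hh⟩ := hcon w hw hw0 χ
  exact hh (hχ h)

/-- If `ψ` is a character of a subgroup `N` through which all commutators act trivially, `ψ`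
extends to the whole group, with a nontrivial value at any given element outside `N`. -/
theorem exists_extension (N : Subgroup H) [N.Normal] (ψ : N →* ℂˣ)
    (hconj : ∀ (h : H) (n : N), ψ (MulAut.conjNormal h n) = ψ n)
    (hab : ∀ h k : H, ∃ hc : h * k * h⁻¹ * k⁻¹ ∈ N, ψ ⟨_, hc⟩ = 1) {u : H} (hu : u ∉ N) :
    ∃ χ : H →* ℂˣ, (∀ n : N, χ n = ψ n) ∧ χ u ≠ 1 := by
  classical
  -- Inside the right regular representation, `S` below is the space of functions with `f (x n) = ψ
  -- n f x` for `n` in `N`, and `f₀` is `ψ` extended by zero.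
  let τ : Representation ℂ H (H → ℂ) :=
    { toFun := fun h ↦ LinearMap.funLeft ℂ ℂ fun x ↦ x * h
      map_one' := by ext; simp [LinearMap.funLeft_apply]
      map_mul' := fun a b ↦ by
        ext f x
        simp [LinearMap.funLeft_apply, mul_assoc] }
  have hτ : ∀ (h : H) (f : H → ℂ) (x : H), τ h f x = f (x * h) := fun _ _ _ ↦ rfl
  let S : Submodule ℂ (H → ℂ) :=
    { carrier := {f | ∀ n : N, τ n f = (ψ n : ℂ) • f}
      zero_mem' := fun n ↦ by simp
      add_mem' := fun {a b} ha hb n ↦ by rw [map_add, ha n, hb n, smul_add]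
      smul_mem' := fun c a ha n ↦ by rw [map_smul, ha n, smul_comm] }
  have hS : ∀ h, ∀ f ∈ S, τ h f ∈ S := by
    intro h f hf n
    have h1 : (n : H) * h = h * (MulAut.conjNormal h⁻¹ n : N) := by
      rw [MulAut.conjNormal_apply]
      group
    rw [← Module.End.mul_apply, ← map_mul, h1, map_mul, Module.End.mul_apply,
      hf (MulAut.conjNormal h⁻¹ n), map_smul, hconj]
  have hcomm : ∀ h k, ∀ f ∈ S, τ h (τ k f) = τ k (τ h f) := by
    intro h k f hf
    obtain ⟨hc, hc1⟩ := hab h k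
    have h1 : h * k = (h * k * h⁻¹ * k⁻¹) * (k * h) := by group
    have h2 := hS k _ (hS h f hf) ⟨_, hc⟩
    rw [hc1, Units.val_one, one_smul] at h2
    rw [← Module.End.mul_apply, ← map_mul, h1, map_mul, map_mul τ k h]
    exact h2
  let f₀ : H → ℂ := fun x ↦ if hx : x ∈ N then (ψ ⟨x, hx⟩ : ℂ) else 0
  have hf₀ : f₀ ∈ S := by
    intro n
    ext x
    rw [hτ, Pi.smul_apply, smul_eq_mul]
    by_cases hx : x ∈ N
    · have hx' : x * n ∈ N := N.mul_mem hx n.2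
      simp only [f₀, hx, hx', dif_pos]
      rw [show (⟨x * n, hx'⟩ : N) = ⟨x, hx⟩ * n from rfl, map_mul, Units.val_mul, mul_comm]
    · have hx' : x * n ∉ N := fun hh ↦ hx ((N.mul_mem_cancel_right n.2).1 hh)
      simp only [f₀, hx, hx', dif_neg, not_false_eq_true, mul_zero]
  by_contra! hcon
  -- A nonzero eigenvector in `S` has a character extending `ψ`. If all extensions were trivial at
  -- `u`, then `u` would fix the span of these eigenvectors, hence `f₀`; but `f₀` vanishes at `u`
  -- and not at 1.
  have hfix : f₀ ∈ LinearMap.ker (τ u - 1) := by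
    refine Submodule.span_le.2 ?_ (le_span_eigenvectors τ S hS hcomm hf₀)
    rintro f ⟨hf, χ, hχ⟩
    by_cases hf0 : f = 0
    · rw [hf0]; exact Submodule.zero_mem _
    have h1 : ∀ n : N, χ n = ψ n := fun n ↦ by
      have := hχ n
      rw [hf n] at this
      exact Units.ext (smul_left_injective ℂ hf0 this).symm
    change τ u f - f = 0
    rw [hχ, hcon χ h1, Units.val_one, one_smul, sub_self]
  have h1 : τ u f₀ 1 = f₀ 1 := congrFun (sub_eq_zero.1 hfix) 1
  rw [hτ, one_mul] at h1
  simp only [f₀, hu, dif_neg, not_false_eq_true, N.one_mem, dif_pos] at h1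
  exact (ψ _).ne_zero h1.symm

end Eigenvectors

/-! ### Clifford theory for representations induced from a linear character -/

section Clifford

open Representation

variable {G : Type*} [Group G] [Finite G] {H N : Subgroup G} (hN : N ≤ H)

omit [Finite G] in
theorem indEv_ind_charRep (χ : H →* ℂˣ) (h : H) (x : IndV H.subtype (charRep χ)) :
    indEv (charRep χ) (ind H.subtype (charRep χ) h x) = χ h * indEv (charRep χ) x := by
  rw [indEv_ind, charRep_apply]

include hN in
/-- If no element outside `H` fixes `χ|N`, the `χ|N`-eigenvectors in the representation induced
from `χ` form a line. -/
theorem eq_smul_of_eigenvector [N.Normal] (χ : H →* ℂˣ)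
    (hns : ∀ g ∉ H, ∃ n : N, χ (Subgroup.inclusion hN (MulAut.conjNormal g n)) ≠
      χ (Subgroup.inclusion hN n))
    (x : IndV H.subtype (charRep χ))
    (hx : ∀ n : N, ind H.subtype (charRep χ) n x = (χ (Subgroup.inclusion hN n) : ℂ) • x) :
    x = indEv (charRep χ) x • IndV.mk H.subtype (charRep χ) 1 (1 : ℂ) := by
  rw [← sub_eq_zero]
  refine eq_zero_of_indEv _ _ fun g ↦ ?_
  rw [map_sub, map_sub, map_smul, map_smul, smul_eq_mul]
  by_cases hg : g ∈ H
  · have h1 := indEv_ind_charRep χ ⟨g, hg⟩ x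
    have h2 := indEv_ind_charRep χ ⟨g, hg⟩ (IndV.mk H.subtype (charRep χ) 1 (1 : ℂ))
    rw [indEv_mk_of_mem _ H.one_mem, charRep_apply] at h2
    simp only at h1 h2
    rw [h1, h2]
    have : (⟨1, H.one_mem⟩⁻¹ : H) = 1 := by simp
    rw [this, map_one, Units.val_one]
    ring
  · rw [ind_mk_one, indEv_mk_of_notMem _ (fun h ↦ hg (H.inv_mem_iff.1 h)), mul_zero, sub_zero]
    -- Off `H` the value of `x` at `g` is scaled both by `χ(n)` and by `χ(g n g⁻¹)`. For a suitable
    -- `n` these differ, so the value is zero.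
    obtain ⟨n, hn⟩ := hns g hg
    have h1 := congrArg (fun y ↦ indEv (charRep χ) (ind H.subtype (charRep χ) g y)) (hx n)
    simp only [map_smul, smul_eq_mul] at h1
    have h2 : g * n = (Subgroup.inclusion hN (MulAut.conjNormal g n) : G) * g := by
      rw [Subgroup.coe_inclusion, MulAut.conjNormal_apply]
      group
    rw [← Module.End.mul_apply, ← map_mul, h2, map_mul, Module.End.mul_apply,
      indEv_ind_charRep] at h1
    have h3 := sub_eq_zero.2 h1
    rw [← sub_mul] at h3
    refine (mul_eq_zero.1 h3).resolve_left (sub_ne_zero.2 ?_)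
    exact_mod_cast hn

include hN in
/-- If no element outside `H` fixes `χ|N`, the representation induced from `χ` is irreducible. -/
theorem ind_charRep_isIrreducible [N.Normal] (χ : H →* ℂˣ)
    (hns : ∀ g ∉ H, ∃ n : N, χ (Subgroup.inclusion hN (MulAut.conjNormal g n)) ≠
      χ (Subgroup.inclusion hN n)) : (ind H.subtype (charRep χ)).IsIrreducible := by
  have := Fintype.ofFinite N
  have hev1 : indEv (charRep χ) (IndV.mk H.subtype (charRep χ) 1 (1 : ℂ)) = 1 := by
    rw [indEv_mk_of_mem _ H.one_mem, charRep_apply]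
    have : (⟨1, H.one_mem⟩⁻¹ : H) = 1 := by simp
    rw [this, map_one, Units.val_one, one_mul]
  have : Nontrivial (IndV H.subtype (charRep χ)) :=
    ⟨IndV.mk H.subtype (charRep χ) 1 (1 : ℂ), 0, fun h ↦ by
      rw [h, map_zero] at hev1; exact zero_ne_one hev1⟩
  refine isIrreducible_of_forall fun S hS x hx hx0 ↦ ?_
  obtain ⟨g, hg⟩ : ∃ g, indEv (charRep χ) (ind H.subtype (charRep χ) g x) ≠ 0 := by
    by_contra! hcon
    exact hx0 (eq_zero_of_indEv _ _ hcon)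
  -- Projection of a translate of `x` to the `χ|N`-eigenspace. Its value at the identity is only
  -- multiplied by `|N|`, so `z` is a nonzero multiple of the generating vector, which therefore
  -- lies in `S`.
  let z := ∑ n : N, ((χ (Subgroup.inclusion hN n))⁻¹ : ℂˣ).val •
    ind H.subtype (charRep χ) n (ind H.subtype (charRep χ) g x)
  have hz : z ∈ S := Submodule.sum_mem _ fun n _ ↦ S.smul_mem _ (hS _ _ (hS _ _ hx))
  have hz1 : ∀ n : N, ind H.subtype (charRep χ) n z = (χ (Subgroup.inclusion hN n) : ℂ) • z := by
    intro n
    simp only [z, map_sum, Finset.smul_sum, smul_smul, map_smul]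
    refine Fintype.sum_equiv (Equiv.mulLeft n) _ _ fun m ↦ ?_
    rw [← Module.End.mul_apply (ind H.subtype (charRep χ) n), ← map_mul]
    simp only [Equiv.coe_mulLeft, map_mul, mul_inv_rev, Units.val_mul, Subgroup.coe_mul]
    congr 1
    rw [mul_comm ((χ (Subgroup.inclusion hN m))⁻¹ : ℂˣ).val, ← mul_assoc, ← Units.val_mul,
      mul_inv_cancel, Units.val_one, one_mul]
  have hz2 : indEv (charRep χ) z ≠ 0 := by
    have : ∀ n : N, indEv (charRep χ) (((χ (Subgroup.inclusion hN n))⁻¹ : ℂˣ).val •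
        ind H.subtype (charRep χ) n (ind H.subtype (charRep χ) g x)) =
        indEv (charRep χ) (ind H.subtype (charRep χ) g x) := by
      intro n
      rw [map_smul]
      have := indEv_ind_charRep χ (Subgroup.inclusion hN n) (ind H.subtype (charRep χ) g x)
      rw [Subgroup.coe_inclusion] at this
      rw [this, smul_eq_mul, ← mul_assoc, ← Units.val_mul, inv_mul_cancel, Units.val_one, one_mul]
    simp only [z, map_sum, this, Finset.sum_const, ← Nat.cast_smul_eq_nsmul ℂ]
    refine smul_ne_zero (Nat.cast_ne_zero.2 ?_) hg
    rw [Finset.card_univ]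
    exact Fintype.card_ne_zero
  have hw : IndV.mk H.subtype (charRep χ) 1 (1 : ℂ) ∈ S := by
    rw [← inv_smul_smul₀ hz2 (IndV.mk H.subtype (charRep χ) 1 (1 : ℂ)),
      ← eq_smul_of_eigenvector hN χ hns z hz1]
    exact S.smul_mem _ hz
  rw [eq_top_iff]
  intro y _
  induction y using indV_induction with
  | h0 => exact S.zero_mem
  | hadd a b ha hb => exact S.add_mem (ha trivial) (hb trivial)
  | hmk g a =>
    have h1 : IndV.mk H.subtype (charRep χ) g a =
        a • ind H.subtype (charRep χ) g⁻¹ (IndV.mk H.subtype (charRep χ) 1 (1 : ℂ)) := by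
      rw [ind_mk_one, inv_inv, ← map_smul, smul_eq_mul, mul_one]
    rw [h1]
    exact S.smul_mem _ (hS _ _ hw)

include hN in
/-- The inducing character is determined by its restriction to `N` and the induced
representation. -/
theorem eq_of_ind_equiv [N.Normal] (χ χ' : H →* ℂˣ)
    (hns : ∀ g ∉ H, ∃ n : N, χ (Subgroup.inclusion hN (MulAut.conjNormal g n)) ≠
      χ (Subgroup.inclusion hN n))
    (hχ : ∀ n : N, χ (Subgroup.inclusion hN n) = χ' (Subgroup.inclusion hN n))
    (e : (ind H.subtype (charRep χ')).Equiv (ind H.subtype (charRep χ))) : χ = χ' := by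
  have hev1 : ∀ χ : H →* ℂˣ, IndV.mk H.subtype (charRep χ) 1 (1 : ℂ) ≠ 0 := by
    intro χ h
    have := indEv_mk_of_mem (charRep χ) H.one_mem 1
    rw [h, map_zero, charRep_apply, mul_one] at this
    exact (χ _).ne_zero this.symm
  have hw : ∀ (χ : H →* ℂˣ) (h : H), ind H.subtype (charRep χ) h
      (IndV.mk H.subtype (charRep χ) 1 (1 : ℂ)) =
      (χ h : ℂ) • IndV.mk H.subtype (charRep χ) 1 (1 : ℂ) := by
    intro χ h
    rw [ind_mk_one_of_mem, charRep_apply, ← map_smul, smul_eq_mul]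
  -- The isomorphism sends the generator to an eigenvector for the common restriction to `N`, hence
  -- into the line of the other generator. On that line `H` acts by `χ`, and by transport it also
  -- acts by `χ'`.
  have h1 := eq_smul_of_eigenvector hN χ hns (e (IndV.mk H.subtype (charRep χ') 1 (1 : ℂ)))
    fun n ↦ by
      rw [← equiv_apply, hχ, ← Subgroup.coe_inclusion hN, hw, equiv_map_smul]
  have h2 := equiv_ne_zero e (hev1 χ')
  ext h
  have h3 := equiv_apply e h (IndV.mk H.subtype (charRep χ') 1 (1 : ℂ))
  rw [hw, equiv_map_smul] at h3
  have h4 : ind H.subtype (charRep χ) h (e (IndV.mk H.subtype (charRep χ') 1 (1 : ℂ))) =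
      (χ h : ℂ) • e (IndV.mk H.subtype (charRep χ') 1 (1 : ℂ)) := by
    rw [h1, map_smul, hw, smul_comm]
  rw [h4] at h3
  exact (smul_left_injective ℂ h2 h3).symm

/-- If `χ` is trivial on `H ∩ K`, the representation induced from `χ` has a nonzero `K`-fixed
vector. -/
theorem exists_fixed_ind_charRep (χ : H →* ℂˣ) (K : Subgroup G)
    (hK : ∀ h : H, (h : G) ∈ K → χ h = 1) :
    ∃ v : IndV H.subtype (charRep χ), v ≠ 0 ∧ ∀ k ∈ K, ind H.subtype (charRep χ) k v = v := by
  classical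
  have := Fintype.ofFinite K
  refine ⟨∑ k : K, ind H.subtype (charRep χ) k (IndV.mk H.subtype (charRep χ) 1 (1 : ℂ)),
    fun h0 ↦ ?_, fun k hk ↦ ?_⟩
  -- The value of the averaged generator at the identity counts the elements of `K ∩ H`, and the
  -- identity is one of them.
  · have h1 : ∀ k : K, indEv (charRep χ) (ind H.subtype (charRep χ) k
        (IndV.mk H.subtype (charRep χ) 1 (1 : ℂ))) = if (k : G) ∈ H then 1 else 0 := by
      intro k
      rw [ind_mk_one]
      split_ifs with hk
      · rw [indEv_mk_of_mem _ (H.inv_mem hk), charRep_apply, hK, Units.val_one, one_mul]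
        simp
      · exact indEv_mk_of_notMem _ (fun h ↦ hk (H.inv_mem_iff.1 h)) _
    have h2 := congrArg (indEv (charRep χ)) h0
    rw [map_sum, map_zero] at h2
    simp only [h1] at h2
    rw [Finset.sum_boole, Nat.cast_eq_zero, Finset.card_eq_zero] at h2
    have : (1 : K) ∈ (∅ : Finset K) := by
      rw [← h2]
      simp
    simp at this
  · rw [map_sum, ← Equiv.sum_comp (Equiv.mulLeft (⟨k, hk⟩ : K))
      (fun x : K ↦ ind H.subtype (charRep χ) x (IndV.mk H.subtype (charRep χ) 1 (1 : ℂ)))]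
    refine Finset.sum_congr rfl fun x _ ↦ ?_
    rw [← Module.End.mul_apply, ← map_mul]
    rfl

end Clifford

/-! ### Embedding into inflated tensor products through regular representations -/

section RegularRepresentation

open Representation

variable {A : Type*} [Group A] {d : ℕ}

/-- The regular representation of a finite group, on a space of finitely supported functions
on `Fin d`. -/
def finRegular (e : A ≃ Fin d) : Representation ℂ A (Fin d →₀ ℂ) where
  toFun a := Finsupp.lmapDomain ℂ ℂ fun i ↦ e (a * e.symm i)
  map_one' := by
    ext
    simp
  map_mul' a b := by
    ext
    simp [mul_assoc]

theorem finRegular_single (e : A ≃ Fin d) (a b : A) :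
    finRegular e a (Finsupp.single (e b) 1) = Finsupp.single (e (a * b)) 1 := by
  simp [finRegular]

variable {G : Type*} [Group G] [Finite G] {H : Subgroup G} {A₁ A₂ : Type*} [Group A₁] [Group A₂]
  [Finite A₁] [Finite A₂] {V : Type*} [AddCommGroup V] [Module ℂ V] {τ : Representation ℂ G V}

/-- An irreducible representation with a nonzero vector fixed by the kernel of
`H → A₁ × A₂` embeds in the representation induced from an inflated exterior tensor product. -/
theorem exists_isSubrepOf_ind_tprod (hτ : τ.IsIrreducible) (r : H →* A₁) (q : H →* A₂) {v : V}
    (hv0 : v ≠ 0) (hv : ∀ h : H, r h = 1 → q h = 1 → τ h v = v) :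
    ∃ (W₁ : Type) (_ : AddCommGroup W₁) (_ : Module ℂ W₁) (_ : FiniteDimensional ℂ W₁)
      (W₂ : Type) (_ : AddCommGroup W₂) (_ : Module ℂ W₂) (_ : FiniteDimensional ℂ W₂)
      (σ₁ : Representation ℂ A₁ W₁) (σ₂ : Representation ℂ A₂ W₂),
      IsSubrepOf τ (ind H.subtype (Representation.tprod (σ₁.comp r) (σ₂.comp q))) := by
  classical
  have := Fintype.ofFinite H
  -- Numbering the groups keeps the regular representations in the lowest universe, as the
  -- definition of the geometric series demands.
  let e₁ := Finite.equivFin A₁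
  let e₂ := Finite.equivFin A₂
  obtain ⟨l, hl⟩ : ∃ l : Module.Dual ℂ V, l v ≠ 0 := by
    by_contra! hcon
    exact hv0 ((Module.forall_dual_apply_eq_zero_iff ℂ v).1 hcon)
  refine ⟨_, inferInstance, inferInstance, inferInstance, _, inferInstance, inferInstance,
    inferInstance, finRegular e₁, finRegular e₂, ?_⟩
  -- `δ h` is the basis vector at the image of `h` in `A₁ × A₂`. The map `f` below collects the
  -- matrix coefficients `l (τ h v)`, placed at `h⁻¹` to make it equivariant.
  let δ : H → TensorProduct ℂ (Fin (Nat.card A₁) →₀ ℂ) (Fin (Nat.card A₂) →₀ ℂ) := fun h ↦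
    TensorProduct.tmul ℂ (Finsupp.single (e₁ (r h)) 1) (Finsupp.single (e₂ (q h)) 1)
  have hδ : ∀ h k : H, Representation.tprod ((finRegular e₁).comp r) ((finRegular e₂).comp q) h
      (δ k) = δ (h * k) := by
    intro h k
    simp only [δ, Representation.tprod_apply, TensorProduct.map_tmul, map_mul]
    congr 1
    · exact finRegular_single e₁ (r h) (r k)
    · exact finRegular_single e₂ (q h) (q k)
  let f : V →ₗ[ℂ] TensorProduct ℂ (Fin (Nat.card A₁) →₀ ℂ) (Fin (Nat.card A₂) →₀ ℂ) :=
    ∑ h : H, (l ∘ₗ τ h).smulRight (δ h⁻¹)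
  have hf : ∀ v, f v = ∑ h : H, l (τ h v) • δ h⁻¹ := fun v ↦ by
    simp [f, LinearMap.sum_apply]
  refine isSubrepOf_ind _ τ hτ f (fun h v ↦ ?_) fun h0 ↦ ?_
  · rw [hf, hf, map_sum]
    refine Fintype.sum_equiv (Equiv.mulRight h) _ _ fun k ↦ ?_
    rw [map_smul, hδ]
    simp
  -- `Φ` reads the coordinate at the identity of `A₁ × A₂`. Only the common kernel of `r` and `q`
  -- contributes, and each of its elements fixes `v` and gives `l v`.
  · let Φ : TensorProduct ℂ (Fin (Nat.card A₁) →₀ ℂ) (Fin (Nat.card A₂) →₀ ℂ) →ₗ[ℂ] ℂ :=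
      LinearMap.mul' ℂ ℂ ∘ₗ TensorProduct.map (Finsupp.lapply (e₁ 1)) (Finsupp.lapply (e₂ 1))
    have h1 : ∀ h : H, l (τ h v) • Φ (δ h⁻¹) = if r h = 1 ∧ q h = 1 then l v else 0 := by
      intro h
      by_cases hr : r h = 1
      · by_cases hq : q h = 1
        · simp [Φ, δ, hr, hq, hv h hr hq]
        · simp [Φ, δ, hr, hq]
      · simp [Φ, δ, hr, Finsupp.single_apply]
    have h2 : Φ (f v) = 0 := by rw [h0]; simp
    rw [hf, map_sum] at h2
    simp only [map_smul, h1] at h2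
    rw [← Finset.sum_filter, Finset.sum_const, ← Nat.cast_smul_eq_nsmul ℂ] at h2
    refine hl ((smul_eq_zero.1 h2).resolve_left (Nat.cast_ne_zero.2 ?_))
    rw [Finset.card_ne_zero]
    exact ⟨1, by simp⟩

end RegularRepresentation

/-! ### The congruence kernel as the additive group of matrices -/

section CongruenceKernel

variable {O : Type*} [CommRing O] [IsLocalRing O] {n : ℕ}

theorem redMap_mk (x : O) :
    redMap O (Ideal.Quotient.mk (IsLocalRing.maximalIdeal O ^ 2) x) = IsLocalRing.residue O x :=
  rfl

theorem redMap_surjective : Function.Surjective (redMap O) := fun x ↦ by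
  obtain ⟨y, rfl⟩ := IsLocalRing.residue_surjective x
  exact ⟨_, redMap_mk y⟩

variable (O n) in
/-- Reduction of `GL_n(𝔬_2)` modulo `𝔭`. -/
abbrev redGL : GLo O n 2 →* Matrix.GeneralLinearGroup (Fin n) (IsLocalRing.ResidueField O) :=
  Matrix.GeneralLinearGroup.map (redMap O)

theorem coe_redGL (g : GLo O n 2) :
    (redGL O n g : Matrix (Fin n) (Fin n) (IsLocalRing.ResidueField O)) =
      (g : Matrix (Fin n) (Fin n) (oMod O 2)).map (redMap O) := rfl

theorem mem_N1_iff (g : GLo O n 2) :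
    g ∈ N1 O n ↔ (g : Matrix (Fin n) (Fin n) (oMod O 2)).map (redMap O) = 1 := by
  rw [N1, MonoidHom.mem_ker, Units.ext_iff]
  rfl

variable {ϖ : O} (hϖ : IsLocalRing.maximalIdeal O = Ideal.span {ϖ})

include hϖ in
theorem mk_uniformizer_sq : Ideal.Quotient.mk (IsLocalRing.maximalIdeal O ^ 2) ϖ *
    Ideal.Quotient.mk (IsLocalRing.maximalIdeal O ^ 2) ϖ = 0 := by
  rw [← map_mul, Ideal.Quotient.eq_zero_iff_mem, pow_two]
  have : ϖ ∈ IsLocalRing.maximalIdeal O := hϖ ▸ Ideal.mem_span_singleton_self ϖ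
  exact Ideal.mul_mem_mul this this

theorem map_one_add_smul (X : Matrix (Fin n) (Fin n) O) :
    (1 + ϖ • X).map (Ideal.Quotient.mk (IsLocalRing.maximalIdeal O ^ 2)) =
      1 + Ideal.Quotient.mk (IsLocalRing.maximalIdeal O ^ 2) ϖ •
        X.map (Ideal.Quotient.mk (IsLocalRing.maximalIdeal O ^ 2)) := by
  ext i j
  by_cases h : i = j <;> simp [h]

/-- The element `1 + ϖ X` of `N_1`. -/
def oneAdd (X : Matrix (Fin n) (Fin n) O) : N1 O n where
  val :=
    { val := (1 + ϖ • X).map (Ideal.Quotient.mk (IsLocalRing.maximalIdeal O ^ 2))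
      inv := (1 + ϖ • (-X)).map (Ideal.Quotient.mk (IsLocalRing.maximalIdeal O ^ 2))
      val_inv := by
        rw [map_one_add_smul, map_one_add_smul, add_mul, mul_add, mul_add, smul_mul_smul_comm,
          mk_uniformizer_sq hϖ]
        ext i j
        simp
      inv_val := by
        rw [map_one_add_smul, map_one_add_smul, add_mul, mul_add, mul_add, smul_mul_smul_comm,
          mk_uniformizer_sq hϖ]
        ext i j
        simp }
  property := by
    rw [mem_N1_iff]
    ext i j
    have : IsLocalRing.residue O ϖ = 0 := by
      rw [IsLocalRing.residue_eq_zero_iff, hϖ]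
      exact Ideal.mem_span_singleton_self ϖ
    by_cases h : i = j <;> simp [redMap_mk, Matrix.one_apply, h, this]

theorem coe_oneAdd (X : Matrix (Fin n) (Fin n) O) :
    (((oneAdd hϖ X : N1 O n) : GLo O n 2) : Matrix (Fin n) (Fin n) (oMod O 2)) =
      (1 + ϖ • X).map (Ideal.Quotient.mk (IsLocalRing.maximalIdeal O ^ 2)) := rfl

theorem exists_eq_oneAdd (g : N1 O n) : ∃ X, g = oneAdd hϖ X := by
  have h := (mem_N1_iff _).1 g.2
  have : ∀ i j, ∃ c, liftMod ((g : GLo O n 2) i j) - (1 : Matrix (Fin n) (Fin n) O) i j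
      = ϖ * c := by
    intro i j
    have h1 : liftMod ((g : GLo O n 2) i j) - (1 : Matrix (Fin n) (Fin n) O) i j ∈
        IsLocalRing.maximalIdeal O := by
      rw [← IsLocalRing.residue_eq_zero_iff, ← redMap_mk, map_sub, mk_liftMod, map_sub]
      have := congrFun (congrFun h i) j
      rw [Matrix.map_apply] at this
      rw [this, redMap_mk, Matrix.one_apply, Matrix.one_apply]
      split_ifs <;> simp
    obtain ⟨c, hc⟩ := Ideal.mem_span_singleton'.1 (hϖ.le h1)
    exact ⟨c, by rw [← hc, mul_comm]⟩
  choose X hX using this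
  refine ⟨Matrix.of X, Subtype.ext (Units.ext (Matrix.ext fun i j ↦ ?_))⟩
  rw [coe_oneAdd, Matrix.map_apply, Matrix.add_apply, Matrix.smul_apply, Matrix.of_apply,
    smul_eq_mul, ← hX, add_sub_cancel, mk_liftMod]

/-- The cross term carries `ϖ²`, which is zero in `𝔬_2`. -/
theorem oneAdd_mul (X Y : Matrix (Fin n) (Fin n) O) :
    oneAdd hϖ X * oneAdd hϖ Y = oneAdd hϖ (X + Y) := by
  refine Subtype.ext (Units.ext ?_)
  rw [Subgroup.coe_mul, Units.val_mul, coe_oneAdd, coe_oneAdd, coe_oneAdd, map_one_add_smul,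
    map_one_add_smul, map_one_add_smul, add_mul, mul_add, mul_add, smul_mul_smul_comm,
    mk_uniformizer_sq hϖ]
  ext i j
  simp [mul_add]
  ring

theorem conj_oneAdd (g : GLo O n 2) (A A' X : Matrix (Fin n) (Fin n) O)
    (hA : A.map (Ideal.Quotient.mk (IsLocalRing.maximalIdeal O ^ 2)) = g)
    (hA' : A'.map (Ideal.Quotient.mk (IsLocalRing.maximalIdeal O ^ 2)) =
      ((g⁻¹ : GLo O n 2) : Matrix (Fin n) (Fin n) (oMod O 2))) :
    MulAut.conjNormal g (oneAdd hϖ X) = oneAdd hϖ (A * X * A') := by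
  refine Subtype.ext (Units.ext ?_)
  rw [MulAut.conjNormal_apply, Units.val_mul, Units.val_mul, coe_oneAdd, coe_oneAdd,
    map_one_add_smul, map_one_add_smul, Matrix.map_mul, Matrix.map_mul, hA, hA', mul_add, add_mul,
    mul_one, ← Units.val_mul, mul_inv_cancel, Units.val_one, Matrix.mul_smul, Matrix.smul_mul]

end CongruenceKernel

/-! ### The characters `ψ_β` and their stabilizers -/

section Characters

variable {O : Type*} [CommRing O] [IsLocalRing O] {n : ℕ} {F : Type*} [Field F] [Algebra O F]
  {ψ : AddChar F ℂˣ} (hψ : ∀ x : O, ψ (algebraMap O F x) = 1)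
  {ϖ : O} (hϖ : IsLocalRing.maximalIdeal O = Ideal.span {ϖ}) (hϖ0 : algebraMap O F ϖ ≠ 0)

include hψ hϖ0 in
theorem psiBeta_oneAdd (B X : Matrix (Fin n) (Fin n) O) :
    psiBeta ψ ϖ (B.map (IsLocalRing.residue O)) (oneAdd hϖ X) =
      ψ ((algebraMap O F ϖ)⁻¹ * algebraMap O F (Matrix.trace (B * X))) :=
  psiBeta_eq hψ hϖ hϖ0 _ _ B X rfl rfl

theorem exists_lift_matrix (β : Matrix (Fin n) (Fin n) (IsLocalRing.ResidueField O)) :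
    ∃ B : Matrix (Fin n) (Fin n) O, B.map (IsLocalRing.residue O) = β :=
  ⟨β.map liftRes, by ext i j; simp [residue_liftRes]⟩

theorem exists_lift_matrix_mod (A : Matrix (Fin n) (Fin n) (oMod O 2)) :
    ∃ B : Matrix (Fin n) (Fin n) O,
      B.map (Ideal.Quotient.mk (IsLocalRing.maximalIdeal O ^ 2)) = A :=
  ⟨A.map liftMod, by ext i j; simp [mk_liftMod]⟩

/-- The character `ψ_β`, as a homomorphism. -/
def psiHom (β : Matrix (Fin n) (Fin n) (IsLocalRing.ResidueField O)) : N1 O n →* ℂˣ :=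
  MonoidHom.mk' (psiBeta ψ ϖ β) fun x y ↦ by
    obtain ⟨B, rfl⟩ := exists_lift_matrix β
    obtain ⟨X, rfl⟩ := exists_eq_oneAdd hϖ x
    obtain ⟨Y, rfl⟩ := exists_eq_oneAdd hϖ y
    rw [oneAdd_mul, psiBeta_oneAdd hψ hϖ hϖ0, psiBeta_oneAdd hψ hϖ hϖ0,
      psiBeta_oneAdd hψ hϖ hϖ0, ← AddChar.map_add_eq_mul, mul_add, Matrix.trace_add, map_add,
      mul_add]

theorem psiHom_apply (β : Matrix (Fin n) (Fin n) (IsLocalRing.ResidueField O)) (x : N1 O n) :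
    psiHom hψ hϖ hϖ0 β x = psiBeta ψ ϖ β x := rfl

-- Cyclicity of the trace moves the conjugation from the group element to `β`.
include hψ hϖ hϖ0 in
theorem psiBeta_conj (β : Matrix (Fin n) (Fin n) (IsLocalRing.ResidueField O)) (g : GLo O n 2)
    (x : N1 O n) :
    psiBeta ψ ϖ β (MulAut.conjNormal g x) =
      psiBeta ψ ϖ (((redGL O n g)⁻¹).val * β * (redGL O n g).val) x := by
  obtain ⟨B, rfl⟩ := exists_lift_matrix β
  obtain ⟨X, rfl⟩ := exists_eq_oneAdd hϖ x
  obtain ⟨A, hA⟩ := exists_lift_matrix_mod (g : Matrix (Fin n) (Fin n) (oMod O 2))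
  obtain ⟨A', hA'⟩ := exists_lift_matrix_mod
    ((g⁻¹ : GLo O n 2) : Matrix (Fin n) (Fin n) (oMod O 2))
  have h1 : ((redGL O n g)⁻¹).val * B.map (IsLocalRing.residue O) * (redGL O n g).val =
      (A' * B * A).map (IsLocalRing.residue O) := by
    rw [Matrix.map_mul, Matrix.map_mul, ← map_inv, coe_redGL, coe_redGL, ← hA, ← hA']
    rfl
  rw [conj_oneAdd hϖ g A A' X hA hA', h1, psiBeta_oneAdd hψ hϖ hϖ0, psiBeta_oneAdd hψ hϖ hϖ0]
  congr 3
  rw [← mul_assoc, Matrix.trace_mul_comm, ← mul_assoc, ← mul_assoc]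

variable (hψ' : ∃ x : O, ψ ((algebraMap O F ϖ)⁻¹ * algebraMap O F x) ≠ 1)

-- If `c` were a unit, `c t` would run through all of `O`, contradicting nontriviality of `ψ` on
-- `𝔭⁻¹`.
include hψ' in
theorem residue_eq_zero_of_forall (c : O)
    (hc : ∀ t, ψ ((algebraMap O F ϖ)⁻¹ * algebraMap O F (c * t)) = 1) :
    IsLocalRing.residue O c = 0 := by
  rw [IsLocalRing.residue_eq_zero_iff, IsLocalRing.mem_maximalIdeal]
  intro hu
  obtain ⟨x, hx⟩ := hψ'
  obtain ⟨d, hd⟩ := hu.exists_right_inv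
  refine hx ?_
  rw [← hc (d * x), ← mul_assoc, hd, one_mul]

-- The trace of `B · t E_{ij}` is `B_{ji} t`, so one root subgroup reads off one entry, with
-- transposed indices. The entrywise form is also what detects vanishing blocks of conjugates of
-- `β`.
include hψ hψ' hϖ0 in
theorem eq_of_psiBeta_single (β β' : Matrix (Fin n) (Fin n) (IsLocalRing.ResidueField O))
    (i j : Fin n) (h : ∀ t : O, psiBeta ψ ϖ β (oneAdd hϖ (Matrix.single i j t)) =
      psiBeta ψ ϖ β' (oneAdd hϖ (Matrix.single i j t))) : β j i = β' j i := by
  obtain ⟨B, rfl⟩ := exists_lift_matrix β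
  obtain ⟨B', rfl⟩ := exists_lift_matrix β'
  rw [← sub_eq_zero, Matrix.map_apply, Matrix.map_apply, ← map_sub]
  refine residue_eq_zero_of_forall hψ' _ fun t ↦ ?_
  have h1 := h t
  rw [psiBeta_oneAdd hψ hϖ hϖ0, psiBeta_oneAdd hψ hϖ hϖ0, Matrix.trace_mul_single,
    Matrix.trace_mul_single] at h1
  have h2 : (algebraMap O F ϖ)⁻¹ * algebraMap O F ((B j i - B' j i) * t) =
      (algebraMap O F ϖ)⁻¹ * algebraMap O F (B j i * t) -
        (algebraMap O F ϖ)⁻¹ * algebraMap O F (B' j i * t) := by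
    rw [← mul_sub, ← map_sub, sub_mul]
  rw [h2, AddChar.map_sub_eq_div]
  simp only [MulOpposite.smul_eq_mul_unop, MulOpposite.unop_op] at h1
  rw [h1, div_self']

include hψ hψ' hϖ0 in
theorem eq_of_psiBeta_eq (β β' : Matrix (Fin n) (Fin n) (IsLocalRing.ResidueField O))
    (h : ∀ x : N1 O n, psiBeta ψ ϖ β x = psiBeta ψ ϖ β' x) (hϖ : IsLocalRing.maximalIdeal O =
      Ideal.span {ϖ}) : β = β' := by
  ext j i
  exact eq_of_psiBeta_single hψ hϖ hϖ0 hψ' β β' i j fun t ↦ h _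

-- Since `ψ_β` determines `β`, fixing `ψ_β` means that the reduction centralizes `β`.
include hψ hψ' hϖ hϖ0 in
theorem mem_stabPsi_iff (β : Matrix (Fin n) (Fin n) (IsLocalRing.ResidueField O))
    (g : GLo O n 2) : g ∈ stabPsi ψ ϖ β ↔ β * (redGL O n g).val = (redGL O n g).val * β := by
  have h1 : g ∈ stabPsi ψ ϖ β ↔
      ∀ x : N1 O n, psiBeta ψ ϖ β (MulAut.conjNormal g x) = psiBeta ψ ϖ β x := Iff.rfl
  rw [h1]
  constructor
  · intro h
    have h2 := eq_of_psiBeta_eq hψ hϖ0 hψ' _ _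
      (fun x ↦ (psiBeta_conj hψ hϖ hϖ0 β g x).symm.trans (h x)) hϖ
    conv_rhs => rw [← h2]
    rw [← mul_assoc, ← mul_assoc, ← Units.val_mul, mul_inv_cancel, Units.val_one, one_mul]
  · intro h x
    rw [psiBeta_conj hψ hϖ hϖ0, mul_assoc, h, ← mul_assoc, ← Units.val_mul, inv_mul_cancel,
      Units.val_one, one_mul]

include hψ hψ' hϖ hϖ0 in
theorem N1_le_stabPsi (β : Matrix (Fin n) (Fin n) (IsLocalRing.ResidueField O)) :
    N1 O n ≤ stabPsi ψ ϖ β := fun g hg ↦ by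
  rw [mem_stabPsi_iff hψ hϖ hϖ0 hψ', show redGL O n g = 1 from hg, Units.val_one, mul_one, one_mul]

include hψ hϖ hϖ0 in
/-- If `h = a n` and `k = b m` where `n`, `m` lie in `N_1` and `a`, `b` commute and fix `ψ_β`,
then `ψ_β` is trivial on the commutator of `h` and `k`. -/
theorem psiBeta_commutator (β : Matrix (Fin n) (Fin n) (IsLocalRing.ResidueField O))
    (a b : GLo O n 2) (x y : N1 O n) (ha : a ∈ stabPsi ψ ϖ β) (hb : b ∈ stabPsi ψ ϖ β)
    (hN : N1 O n ≤ stabPsi ψ ϖ β) (hab : a * b = b * a) :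
    ∃ hc : (a * x) * (b * y) * (a * x)⁻¹ * (b * y)⁻¹ ∈ N1 O n, psiBeta ψ ϖ β ⟨_, hc⟩ = 1 := by
  have hs : ∀ g ∈ stabPsi ψ ϖ β, ∀ z : N1 O n,
      psiHom hψ hϖ hϖ0 β (MulAut.conjNormal g z) = psiHom hψ hϖ hϖ0 β z := fun g hg z ↦ hg z
  have hk : b * y ∈ stabPsi ψ ϖ β := mul_mem hb (hN y.2)
  -- As `a` and `b` commute, the commutator regroups as `a (x · (by) x⁻¹ (by)⁻¹) a⁻¹` times `b (a y
  -- a⁻¹ · y⁻¹) b⁻¹`. In each factor an element of `N1` meets a conjugate of its inverse, and `ψ_β`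
  -- does not see the conjugations.
  let z : N1 O n := MulAut.conjNormal a (x * MulAut.conjNormal (b * y) x⁻¹) *
    MulAut.conjNormal b (MulAut.conjNormal a y * y⁻¹)
  have hz : (a * x) * (b * y) * (a * x)⁻¹ * (b * y)⁻¹ = z := by
    simp only [z, Subgroup.coe_mul, MulAut.conjNormal_apply, Subgroup.coe_inv, mul_inv_rev]
    have h1 : b⁻¹ * a⁻¹ = a⁻¹ * b⁻¹ := by rw [← mul_inv_rev, hab, mul_inv_rev]
    have h2 : a * x * (b * y) * ((x : GLo O n 2)⁻¹ * a⁻¹) * ((y : GLo O n 2)⁻¹ * b⁻¹) =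
      a * (x * (b * y * (x : GLo O n 2)⁻¹ * ((y : GLo O n 2)⁻¹ * b⁻¹))) * a⁻¹ *
        ((a * b) * y * (b⁻¹ * a⁻¹)⁻¹⁻¹ * b * (y : GLo O n 2)⁻¹ * b⁻¹) := by
      rw [h1]
      group
    rw [h2, hab, h1]
    group
  rw [hz]
  refine ⟨z.2, ?_⟩
  change psiHom hψ hϖ hϖ0 β z = 1
  simp only [z]
  simp only [MonoidHom.map_mul (psiHom hψ hϖ hϖ0 β), hs a ha, hs b hb, hs _ hk, map_inv,
    mul_inv_cancel, mul_one]

end Characters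

/-! ### Linear algebra of the matrix `(η, 1; 0, η)` -/

section Quadratic

variable {κ : Type*} [Field κ] {t c : κ}

/-- The matrix of multiplication by a root `η` of `x² - t x + c` in the basis `1, η`. -/
def etaMat {R : Type*} [CommRing R] (t c : R) : Matrix (Fin 2) (Fin 2) R := !![0, -c; 1, t]

section

variable {R : Type*} [CommRing R] (t c : R)

@[simp] theorem etaMat_zero_zero : etaMat t c 0 0 = 0 := rfl
@[simp] theorem etaMat_zero_one : etaMat t c 0 1 = -c := rfl
@[simp] theorem etaMat_one_zero : etaMat t c 1 0 = 1 := rfl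
@[simp] theorem etaMat_one_one : etaMat t c 1 1 = t := rfl

end

/-- The first basis vector is cyclic for `η`, so a commuting matrix is determined by its first
column: `Y = Y₀₀ + Y₁₀ η`. -/
theorem eq_of_commute_etaMat {Y : Matrix (Fin 2) (Fin 2) κ}
    (h : Y * etaMat t c = etaMat t c * Y) :
    Y 0 1 = -c * Y 1 0 ∧ Y 1 1 = Y 0 0 + t * Y 1 0 := by
  have h00 := congrFun (congrFun h 0) 0
  have h10 := congrFun (congrFun h 1) 0
  simp [Matrix.mul_apply, Fin.sum_univ_two] at h00 h10
  exact ⟨by linear_combination h00, by linear_combination h10⟩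

/-- A commutator with `η` that commutes with `η` vanishes, since `η` is separable. -/
theorem eq_zero_of_commute_etaMat (hD : t * t - 4 * c ≠ 0) {X Y : Matrix (Fin 2) (Fin 2) κ}
    (h : Y * etaMat t c = etaMat t c * Y) (hXY : etaMat t c * X - X * etaMat t c = Y) : Y = 0 := by
  obtain ⟨h1, h2⟩ := eq_of_commute_etaMat h
  have e00 := congrFun (congrFun hXY 0) 0
  have e01 := congrFun (congrFun hXY 0) 1
  have e10 := congrFun (congrFun hXY 1) 0
  have e11 := congrFun (congrFun hXY 1) 1
  simp [Matrix.mul_apply, Fin.sum_univ_two] at e00 e01 e10 e11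
  -- With `Y = Y₀₀ + Y₁₀ η`, the next two equations say that `Y` and `(t - η) Y` have trace zero, as
  -- commutators with `η` must. The determinant of this system is `4c - t²`.
  have h3 : 2 * Y 0 0 + t * Y 1 0 = 0 := by linear_combination -h2 - e00 - e11
  have h4 : 2 * c * Y 1 0 + t * Y 0 0 = 0 := by
    linear_combination h1 + e01 - c * e10 - t * e00
  have y10 : Y 1 0 = 0 := by
    refine (mul_eq_zero.1 (?_ : (t * t - 4 * c) * Y 1 0 = 0)).resolve_left hD
    linear_combination t * h3 - 2 * h4
  have y00 : Y 0 0 = 0 := by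
    refine (mul_eq_zero.1 (?_ : (t * t - 4 * c) * Y 0 0 = 0)).resolve_left hD
    linear_combination t * h4 - 2 * c * h3
  rw [y10, mul_zero] at h1
  rw [y00, y10, mul_zero, add_zero] at h2
  ext i j
  fin_cases i <;> fin_cases j <;> assumption

/-- The block matrix `(A, B; C, D)` of size `4`. -/
abbrev blocks {R : Type*} (A B C D : Matrix (Fin 2) (Fin 2) R) : Matrix (Fin 4) (Fin 4) R :=
  Matrix.reindex (finSumFinEquiv (m := 2) (n := 2)) (finSumFinEquiv (m := 2) (n := 2))
    (Matrix.fromBlocks A B C D)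

theorem exists_eq_blocks {R : Type*} (M : Matrix (Fin 4) (Fin 4) R) :
    ∃ A B C D, M = blocks A B C D := by
  let N := (Matrix.reindex (finSumFinEquiv (m := 2) (n := 2))
    (finSumFinEquiv (m := 2) (n := 2))).symm M
  refine ⟨N.toBlocks₁₁, N.toBlocks₁₂, N.toBlocks₂₁, N.toBlocks₂₂, ?_⟩
  rw [blocks, Matrix.fromBlocks_toBlocks]
  exact (Equiv.apply_symm_apply _ M).symm

theorem blocks_mul {R : Type*} [CommRing R] (A B C D A' B' C' D' : Matrix (Fin 2) (Fin 2) R) :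
    blocks A B C D * blocks A' B' C' D' =
      blocks (A * A' + B * C') (A * B' + B * D') (C * A' + D * C') (C * B' + D * D') := by
  rw [blocks, blocks, Matrix.reindex_apply, Matrix.reindex_apply, Matrix.submatrix_mul_equiv,
    Matrix.fromBlocks_multiply]
  rfl

theorem blocks_inj {R : Type*} {A B C D A' B' C' D' : Matrix (Fin 2) (Fin 2) R} :
    blocks A B C D = blocks A' B' C' D' ↔ A = A' ∧ B = B' ∧ C = C' ∧ D = D' := by
  rw [blocks, blocks, Equiv.apply_eq_iff_eq, Matrix.fromBlocks_inj]

/-- The matrix `(η, 1; 0, η)`. -/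
abbrev jordanMat {R : Type*} [CommRing R] (t c : R) : Matrix (Fin 4) (Fin 4) R :=
  blocks (etaMat t c) 1 0 (etaMat t c)

/-- The matrix `(p + q η, r + s η; 0, p + q η)`. -/
def centMat {R : Type*} [CommRing R] (t c p q r s : R) : Matrix (Fin 4) (Fin 4) R :=
  blocks (p • 1 + q • etaMat t c) (r • 1 + s • etaMat t c) 0 (p • 1 + q • etaMat t c)

theorem centMat_commute {R : Type*} [CommRing R] (t c p q r s p' q' r' s' : R) :
    centMat t c p q r s * centMat t c p' q' r' s' =
      centMat t c p' q' r' s' * centMat t c p q r s := by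
  have h : ∀ a b a' b' : R, (a • (1 : Matrix (Fin 2) (Fin 2) R) + b • etaMat t c) *
      (a' • 1 + b' • etaMat t c) = (a' • 1 + b' • etaMat t c) * (a • 1 + b • etaMat t c) := by
    intro a b a' b'
    simp only [mul_add, add_mul, smul_mul_smul_comm, one_mul, mul_one, mul_comm a', mul_comm b']
    abel
  simp only [centMat, blocks_mul, mul_zero, zero_mul, add_zero, zero_add]
  rw [h p q p' q', h p q r' s', h r s p' q', add_comm ((r' • (1 : Matrix (Fin 2) (Fin 2) R) + _) * _)]

theorem jordanMat_eq_centMat {R : Type*} [CommRing R] (t c : R) :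
    jordanMat t c = centMat t c 0 1 1 0 := by
  simp [centMat]

/-- Comparing blocks, `C` commutes with `η` and equals `[η, D]`, so it vanishes. Then `A - D`
commutes with `η` and equals `[η, B]`, so `A = D`. What remains says that `A` and `B` commute with
`η`. -/
theorem exists_eq_centMat (hD : t * t - 4 * c ≠ 0) {M : Matrix (Fin 4) (Fin 4) κ}
    (h : jordanMat t c * M = M * jordanMat t c) : ∃ p q r s, M = centMat t c p q r s := by
  obtain ⟨A, B, C, D, rfl⟩ := exists_eq_blocks M
  rw [blocks_mul, blocks_mul, blocks_inj] at h
  simp only [one_mul, mul_one, zero_mul, mul_zero, add_zero, zero_add] at h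
  obtain ⟨h1, h2, h3, h4⟩ := h
  have hC : C = 0 := eq_zero_of_commute_etaMat hD (X := D) h3.symm (by rw [h4]; abel)
  subst hC
  rw [add_zero] at h1
  rw [zero_add] at h4
  have hAD : A - D = 0 := eq_zero_of_commute_etaMat hD (X := B)
    (by rw [sub_mul, mul_sub, h1, h4]) (by
      rw [sub_eq_sub_iff_add_eq_add, h2])
  rw [sub_eq_zero] at hAD
  subst hAD
  have hB : B * etaMat t c = etaMat t c * B := by
    rw [add_comm] at h2
    exact (add_left_cancel h2).symm
  have key : ∀ Y : Matrix (Fin 2) (Fin 2) κ, Y * etaMat t c = etaMat t c * Y →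
      Y = Y 0 0 • 1 + Y 1 0 • etaMat t c := by
    intro Y hY
    obtain ⟨y1, y2⟩ := eq_of_commute_etaMat hY
    ext i j
    fin_cases i <;> fin_cases j <;> simp [etaMat, y1, y2, mul_comm]
  refine ⟨A 0 0, A 1 0, B 0 0, B 1 0, ?_⟩
  rw [centMat, ← key A h1.symm, ← key B hB]

/-- An invariant plane of the regular matrix `(η, 1; 0, η)` is the standard one. -/
theorem eq_zero_of_invariant (hD : t * t - 4 * c ≠ 0)
    (ha : ∀ x y : κ, x * x + t * x * y + c * y * y = 0 → x = 0 ∧ y = 0)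
    {A B C D A' B' D' : Matrix (Fin 2) (Fin 2) κ}
    (h : jordanMat t c * blocks A B C D = blocks A B C D * blocks A' B' 0 D') : C = 0 := by
  rw [blocks_mul, blocks_mul, blocks_inj] at h
  simp only [one_mul, zero_mul, mul_zero, add_zero, zero_add] at h
  obtain ⟨h1, -, h3, -⟩ := h
  by_cases hC : C.det = 0
  -- The off-diagonal entries of this product are, up to sign, the form `x² + t x y + c y²` at the
  -- two columns of `C`; anisotropy kills both columns.
  · have h5 : C.adjugate * (etaMat t c * C) = 0 := by
      rw [h3, ← mul_assoc, Matrix.adjugate_mul, hC, zero_smul, zero_mul]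
    rw [Matrix.adjugate_fin_two] at h5
    have e10 := congrFun (congrFun h5 1) 0
    have e01 := congrFun (congrFun h5 0) 1
    simp [Matrix.mul_apply, Fin.sum_univ_two] at e10 e01
    obtain ⟨c00, c10⟩ := ha (C 0 0) (C 1 0) (by linear_combination e10)
    obtain ⟨c01, c11⟩ := ha (C 0 1) (C 1 1) (by linear_combination -e01)
    ext i j
    fin_cases i <;> fin_cases j <;> assumption
  -- For invertible `C`, the matrix `X = A C⁻¹` would satisfy `X η - η X = 1`, exhibiting 1 as a
  -- commutator with `η` that commutes with `η`.
  · exfalso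
    have hu : IsUnit C.det := Ne.isUnit hC
    have h6 : C * A' * C⁻¹ = etaMat t c := by
      rw [← h3, mul_assoc, Matrix.mul_nonsing_inv C hu, mul_one]
    have h7 : etaMat t c * (A * C⁻¹) + 1 = A * C⁻¹ * etaMat t c := by
      have := congrArg (· * C⁻¹) h1
      simp only [add_mul, Matrix.mul_nonsing_inv C hu] at this
      rw [← mul_assoc, this, ← h6, ← mul_assoc, ← mul_assoc, mul_assoc A C⁻¹ C,
        Matrix.nonsing_inv_mul C hu, mul_one]
    have h8 : (1 : Matrix (Fin 2) (Fin 2) κ) = 0 := eq_zero_of_commute_etaMat hD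
      (X := -(A * C⁻¹)) (by rw [one_mul, mul_one]) (by
        rw [mul_neg, neg_mul, ← h7]
        abel)
    exact one_ne_zero h8

/-- The characteristic polynomial is the square of `l² - t l + c`, the value of the anisotropic form
at `(l, -1)`. -/
theorem det_jordanMat_sub_ne_zero
    (ha : ∀ x y : κ, x * x + t * x * y + c * y * y = 0 → x = 0 ∧ y = 0) (l : κ) :
    (jordanMat t c - l • 1).det ≠ 0 := by
  have h1 : jordanMat t c - l • 1 = blocks (etaMat t c - l • 1) 1 0 (etaMat t c - l • 1) := by
    have : (1 : Matrix (Fin 4) (Fin 4) κ) = blocks 1 0 0 1 := by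
      rw [blocks, Matrix.fromBlocks_one, Matrix.reindex_apply, Matrix.submatrix_one_equiv]
    rw [this]
    ext i j
    simp only [blocks, Matrix.reindex_apply, Matrix.sub_apply, Matrix.smul_apply,
      Matrix.submatrix_apply]
    rcases (finSumFinEquiv (m := 2) (n := 2)).symm i with i | i <;>
      rcases (finSumFinEquiv (m := 2) (n := 2)).symm j with j | j <;>
      simp
  have h2 : (etaMat t c - l • 1).det ≠ 0 := by
    intro h
    rw [Matrix.det_fin_two] at h
    simp [etaMat] at h
    have := (ha l (-1) (by linear_combination h)).2
    simp at this
  rw [h1, blocks, Matrix.det_reindex_self, Matrix.det_fromBlocks_zero₂₁]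
  exact mul_ne_zero h2 h2

theorem det_conj_jordanMat_sub_ne_zero
    (ha : ∀ x y : κ, x * x + t * x * y + c * y * y = 0 → x = 0 ∧ y = 0) (l : κ)
    (u : Matrix.GeneralLinearGroup (Fin 4) κ) :
    ((u⁻¹).val * jordanMat t c * u.val - l • 1).det ≠ 0 := by
  have : (u⁻¹).val * jordanMat t c * u.val - l • 1 =
      (u⁻¹).val * (jordanMat t c - l • 1) * u.val := by
    rw [mul_sub, sub_mul, Matrix.mul_smul, mul_one, Matrix.smul_mul, ← Units.val_mul,
      inv_mul_cancel, Units.val_one]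
  rw [this, Matrix.det_units_conj']
  exact det_jordanMat_sub_ne_zero ha l

/-- Otherwise a basis vector would be an eigenvector of a conjugate: there is no invariant line. -/
theorem conj_jordanMat_column
    (ha : ∀ x y : κ, x * x + t * x * y + c * y * y = 0 → x = 0 ∧ y = 0)
    (u : Matrix.GeneralLinearGroup (Fin 4) κ) (j : Fin 4) :
    ∃ i, i ≠ j ∧ ((u⁻¹).val * jordanMat t c * u.val) i j ≠ 0 := by
  by_contra! hcon
  refine det_conj_jordanMat_sub_ne_zero ha (((u⁻¹).val * jordanMat t c * u.val) j j) u
    (Matrix.det_eq_zero_of_column_eq_zero j fun i ↦ ?_)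
  by_cases hij : i = j
  · subst hij; simp
  · rw [Matrix.sub_apply, hcon i hij, Matrix.smul_apply, Matrix.one_apply_ne hij, smul_zero,
      sub_zero]

/-- The dual statement: there is no invariant hyperplane. -/
theorem conj_jordanMat_row
    (ha : ∀ x y : κ, x * x + t * x * y + c * y * y = 0 → x = 0 ∧ y = 0)
    (u : Matrix.GeneralLinearGroup (Fin 4) κ) (i : Fin 4) :
    ∃ j, j ≠ i ∧ ((u⁻¹).val * jordanMat t c * u.val) i j ≠ 0 := by
  by_contra! hcon
  refine det_conj_jordanMat_sub_ne_zero ha (((u⁻¹).val * jordanMat t c * u.val) i i) u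
    (Matrix.det_eq_zero_of_row_eq_zero i fun j ↦ ?_)
  by_cases hij : j = i
  · subst hij; simp
  · rw [Matrix.sub_apply, hcon j hij, Matrix.smul_apply, Matrix.one_apply_ne (Ne.symm hij),
      smul_zero, sub_zero]

variable {E : Type*} [Field E] [Algebra κ E] {b : Module.Basis (Fin 2) κ E} {η : E}
  (hb : ⇑b = ![1, η])

include hb in
theorem eq_zero_of_basis {x y : κ} (h : algebraMap κ E x + algebraMap κ E y * η = 0) :
    x = 0 ∧ y = 0 := by
  have hli := b.linearIndependent
  rw [hb, LinearIndependent.pair_iff] at hli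
  exact hli x y (by rw [Algebra.smul_def, Algebra.smul_def, mul_one, h])

include hb in
theorem eta_sq : η * η = algebraMap κ E (b.repr (η * η) 1) * η -
    algebraMap κ E (-b.repr (η * η) 0) := by
  conv_lhs => rw [← b.sum_repr (η * η)]
  rw [Fin.sum_univ_two, hb]
  simp [Algebra.smul_def]
  ring

-- The form is the norm of `x + y η`: it factors as `(x + y η)(x + t y - y η)` in the field `E`.
include hb in
theorem quadratic_anisotropic (hη : η * η = algebraMap κ E t * η - algebraMap κ E c) (x y : κ)
    (h : x * x + t * x * y + c * y * y = 0) : x = 0 ∧ y = 0 := by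
  have h1 : (algebraMap κ E x + algebraMap κ E y * η) *
      (algebraMap κ E (x + t * y) + algebraMap κ E (-y) * η) = 0 := by
    have := congrArg (algebraMap κ E) h
    simp only [map_add, map_mul, map_zero, map_neg] at this ⊢
    linear_combination this - (algebraMap κ E y) ^ 2 * hη
  rcases mul_eq_zero.1 h1 with h2 | h2
  · exact eq_zero_of_basis hb h2
  · obtain ⟨h3, h4⟩ := eq_zero_of_basis hb h2
    rw [neg_eq_zero] at h4
    subst h4
    exact ⟨by simpa using h3, rfl⟩

-- Since `t² - 4c = (2η - t)²`, its vanishing forces `2 = 0` and `t = 0`. In a finite field of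
-- characteristic 2, `c` is a square `s²`, and then `(s + η)² = 0`, which is absurd. This is
-- separability of a quadratic extension of a finite field.
include hb in
theorem quadratic_discriminant_ne_zero [Finite κ]
    (hη : η * η = algebraMap κ E t * η - algebraMap κ E c) : t * t - 4 * c ≠ 0 := by
  intro h
  have h1 : (algebraMap κ E (-t) + algebraMap κ E 2 * η) ^ 2 = 0 := by
    have := congrArg (algebraMap κ E) h
    simp only [map_sub, map_mul, map_zero, map_neg, map_ofNat] at this ⊢
    linear_combination this + 4 * hη
  obtain ⟨ht, h2⟩ := eq_zero_of_basis hb (pow_eq_zero_iff two_ne_zero |>.1 h1)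
  rw [neg_eq_zero] at ht
  subst ht
  have hchar : ringChar κ = 2 := CharP.ringChar_of_prime_eq_zero Nat.prime_two (by exact_mod_cast h2)
  have := Fintype.ofFinite κ
  obtain ⟨s, hs⟩ := FiniteField.isSquare_of_char_two hchar c
  have h3 : (algebraMap κ E s + algebraMap κ E 1 * η) ^ 2 = 0 := by
    have e1 := congrArg (algebraMap κ E) hs
    have e2 := congrArg (algebraMap κ E) h2
    simp only [map_mul, map_zero, map_one, map_ofNat, zero_mul, zero_sub] at e1 e2 hη ⊢
    linear_combination hη - e1 + (algebraMap κ E s) * η * e2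
  exact one_ne_zero (eq_zero_of_basis hb (pow_eq_zero_iff two_ne_zero |>.1 h3)).2

include hb in
theorem betaOne_eq (hη : η * η = algebraMap κ E t * η - algebraMap κ E c) :
    betaOne b η = jordanMat t c := by
  have hb0 : b 0 = 1 := by rw [hb]; rfl
  have hb1 : b 1 = η := by rw [hb]; rfl
  have h0 : b.repr η = Finsupp.single 1 1 := by rw [← hb1, b.repr_self]
  have h1 : b.repr (η * η) = t • Finsupp.single 1 1 - c • Finsupp.single 0 1 := by
    have : η * η = t • b 1 - c • b 0 := by
      rw [hb0, hb1, hη, Algebra.smul_def, Algebra.smul_def, mul_one]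
    rw [this, map_sub, map_smul, map_smul, b.repr_self, b.repr_self]
  have : Algebra.leftMulMatrix b η = etaMat t c := by
    ext i j
    rw [Algebra.leftMulMatrix_eq_repr_mul]
    fin_cases j
    · change b.repr (η * b 0) i = _
      rw [hb0, mul_one, h0]
      fin_cases i <;> simp [etaMat]
    · change b.repr (η * b 1) i = _
      rw [hb1, h1]
      fin_cases i <;> simp [etaMat]
  rw [betaOne, this]

end Quadratic

/-! ### Elementary matrices and linear characters -/

section Transvections

variable {A : Type*} [CommRing A] {n : ℕ}

/-- The elementary matrix `1 + a E_{ij}`. -/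
def elementary (i j : Fin n) (hij : i ≠ j) (a : A) : Matrix.GeneralLinearGroup (Fin n) A where
  val := Matrix.transvection i j a
  inv := Matrix.transvection i j (-a)
  val_inv := by
    rw [Matrix.transvection_mul_transvection_same i j hij, add_neg_cancel,
      Matrix.transvection_zero]
  inv_val := by
    rw [Matrix.transvection_mul_transvection_same i j hij, neg_add_cancel,
      Matrix.transvection_zero]

theorem coe_elementary (i j : Fin n) (hij : i ≠ j) (a : A) :
    (elementary i j hij a : Matrix (Fin n) (Fin n) A) = 1 + Matrix.single i j a := rfl

/-- The commutator relation behind the vanishing of linear characters: with a third index available,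
every elementary matrix is a commutator. -/
theorem elementary_mul_elementary {i j k : Fin n} (hij : i ≠ j) (hik : i ≠ k) (hkj : k ≠ j)
    (a : A) : elementary i k hik a * elementary k j hkj 1 =
      elementary i j hij a * elementary k j hkj 1 * elementary i k hik a := by
  refine Units.ext ?_
  simp only [Units.val_mul, coe_elementary, mul_add, add_mul, mul_one, one_mul,
    Matrix.single_mul_single_same, Matrix.single_mul_single_of_ne _ _ _ _ hkj.symm,
    Matrix.single_mul_single_of_ne _ _ _ _ hij.symm, zero_mul]
  abel

/-- Linear characters of `GL_n`, `n ≥ 3`, are trivial on elementary matrices. -/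
theorem character_elementary (ω : Matrix.GeneralLinearGroup (Fin n) A →* ℂˣ) {i j k : Fin n}
    (hij : i ≠ j) (hik : i ≠ k) (hkj : k ≠ j) (a : A) : ω (elementary i j hij a) = 1 := by
  have h := congrArg ω (elementary_mul_elementary hij hik hkj a)
  rw [map_mul, map_mul, map_mul, mul_assoc, mul_comm (ω (elementary k j hkj 1))] at h
  exact (mul_eq_right.1 h.symm)

theorem character_elementary_four (ω : Matrix.GeneralLinearGroup (Fin 4) A →* ℂˣ) {i j : Fin 4}
    (hij : i ≠ j) (a : A) : ω (elementary i j hij a) = 1 := by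
  obtain ⟨k, hik, hkj⟩ : ∃ k, i ≠ k ∧ k ≠ j := by
    revert i j
    decide
  exact character_elementary ω hij hik hkj a

end Transvections

/-! ### Parabolic and unipotent subgroups in matrix terms -/

section Stabilizers

variable {A : Type*} [CommRing A] {n : ℕ}

theorem glAut_apply_apply (g : Matrix.GeneralLinearGroup (Fin n) A) (v : Fin n → A) (i : Fin n) :
    glAut A n g v i = ∑ j, g i j * v j := rfl

theorem eq_sum_one_mul (v : Fin n → A) (i : Fin n) :
    v i = ∑ j, (1 : Matrix (Fin n) (Fin n) A) i j * v j := by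
  simp [Matrix.one_apply]

theorem conj_mem_map_ker {G B : Type*} [Group G] [Group B] {H : Subgroup G} (f : H →* B) {p u : G}
    (hp : p ∈ H) (hu : u ∈ f.ker.map H.subtype) : p⁻¹ * u * p ∈ f.ker.map H.subtype := by
  obtain ⟨q, hq, rfl⟩ := hu
  refine ⟨⟨p, hp⟩⁻¹ * q * ⟨p, hp⟩, ?_, rfl⟩
  have := f.normal_ker.conj_mem q hq ⟨p, hp⟩⁻¹
  rwa [inv_inv] at this

theorem mem_ker_prod_iff (L : Submodule A (Fin n → A)) (q : stab L) :
    q ∈ ((resHom L).prod (quotHom L)).ker ↔ resHom L q = 1 ∧ quotHom L q = 1 := by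
  rw [MonoidHom.mem_ker, MonoidHom.prod_apply, Prod.mk_eq_one]

theorem mem_stab_of_forall {L : Submodule A (Fin n → A)} {g : Matrix.GeneralLinearGroup (Fin n) A}
    (h : ∀ v ∈ L, glAut A n g v = v) : g ∈ stab L := by
  change L.map (glAut A n g : (Fin n → A) →ₗ[A] (Fin n → A)) = L
  ext v
  constructor
  · rintro ⟨w, hw, rfl⟩
    change glAut A n g w ∈ L
    rwa [h w hw]
  · exact fun hv ↦ ⟨v, hv, h v hv⟩

/-- An injective image of the finite set `L` inside `L` is all of `L`. -/
theorem mem_stab_of_finite [Finite A] {L : Submodule A (Fin n → A)}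
    {g : Matrix.GeneralLinearGroup (Fin n) A} (h : ∀ v ∈ L, glAut A n g v ∈ L) : g ∈ stab L := by
  change L.map (glAut A n g : (Fin n → A) →ₗ[A] (Fin n → A)) = L
  refine SetLike.coe_injective (Set.eq_of_subset_of_ncard_le ?_ ?_)
  · rintro _ ⟨w, hw, rfl⟩
    exact h w hw
  · rw [Submodule.map_coe]
    exact (Set.ncard_image_of_injective _ (glAut A n g).injective).ge

theorem mem_ker_resHom_of_forall {L : Submodule A (Fin n → A)}
    {g : Matrix.GeneralLinearGroup (Fin n) A} (h : ∀ v ∈ L, glAut A n g v = v) :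
    g ∈ (resHom L).ker.map (stab L).subtype :=
  ⟨⟨g, mem_stab_of_forall h⟩, LinearEquiv.ext fun v ↦ Subtype.ext (h v v.2), rfl⟩

theorem mem_geomU_iff {m : ℕ} {g : Matrix.GeneralLinearGroup (Fin n) A} :
    g ∈ geomU A n m ↔ ∀ i j : Fin n, (j : ℕ) < m ∨ m ≤ i → g i j = (1 : Matrix _ _ A) i j := by
  have hcol : ∀ i j : Fin n, glAut A n g (Pi.single j 1) i = g i j := fun i j ↦ by
    rw [glAut_apply, Matrix.mulVec_single_one]
    rfl
  constructor
  · rintro ⟨p, hp, rfl⟩ i j hij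
    obtain ⟨h1, h2⟩ := (mem_ker_prod_iff _ p).1 hp
    rw [Subgroup.coe_subtype] at hcol ⊢
    rw [← hcol, Matrix.one_apply]
    by_cases hj : (j : ℕ) < m
    · have hv : (Pi.single j 1 : Fin n → A) ∈ coordSub A n m := fun i hi ↦
        Pi.single_eq_of_ne (by rintro rfl; omega) 1
      have h3 := congrArg Subtype.val (LinearEquiv.congr_fun h1 ⟨_, hv⟩)
      change glAut A n p (Pi.single j 1) = Pi.single j 1 at h3
      rw [h3, Pi.single_apply]
    · have hi : m ≤ i := hij.resolve_left hj
      have h3 := LinearEquiv.congr_fun h2 (Submodule.Quotient.mk (Pi.single j 1))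
      change Submodule.Quotient.mk (glAut A n p (Pi.single j 1)) =
        Submodule.Quotient.mk (Pi.single j 1) at h3
      have h4 := (Submodule.Quotient.eq _).1 h3 i hi
      rw [Pi.sub_apply, sub_eq_zero] at h4
      rw [h4, Pi.single_apply]
  · intro h
    have hL : ∀ v ∈ coordSub A n m, glAut A n g v = v := by
      intro v hv
      ext i
      rw [glAut_apply_apply, eq_sum_one_mul v i]
      refine Finset.sum_congr rfl fun j _ ↦ ?_
      by_cases hj : (j : ℕ) < m
      · rw [h i j (.inl hj)]
      · rw [hv j (not_lt.1 hj), mul_zero, mul_zero]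
    refine ⟨⟨g, mem_stab_of_forall hL⟩, (mem_ker_prod_iff _ _).2 ⟨?_, ?_⟩, rfl⟩
    · exact LinearEquiv.ext fun v ↦ Subtype.ext (hL v v.2)
    · refine LinearEquiv.ext fun x ↦ ?_
      induction x using Submodule.Quotient.induction_on with
      | H v =>
        refine (Submodule.Quotient.eq _).2 fun i hi ↦ ?_
        rw [Pi.sub_apply, sub_eq_zero]
        change glAut A n g v i = v i
        rw [glAut_apply_apply, eq_sum_one_mul v i]
        exact Finset.sum_congr rfl fun j _ ↦ by rw [h i j (.inr hi)]

theorem elementary_mem_geomU {m : ℕ} {i j : Fin n} (hi : (i : ℕ) < m) (hj : m ≤ j) (a : A) :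
    elementary i j (fun h ↦ by subst h; omega) a ∈ geomU A n m := by
  rw [mem_geomU_iff]
  intro k l hkl
  rw [coe_elementary, Matrix.add_apply, Matrix.single_apply_of_ne, add_zero]
  rintro ⟨rfl, rfl⟩
  omega

/-- The parabolic subgroup normalizes `U`. -/
theorem conj_mem_geomU [Finite A] {m : ℕ} {p u : Matrix.GeneralLinearGroup (Fin n) A}
    (hp : ∀ i j : Fin n, m ≤ i → (j : ℕ) < m → p i j = 0) (hu : u ∈ geomU A n m) :
    p⁻¹ * u * p ∈ geomU A n m := by
  have hps : p ∈ stab (coordSub A n m) := by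
    refine mem_stab_of_finite fun v hv i hi ↦ ?_
    rw [glAut_apply_apply]
    refine Finset.sum_eq_zero fun j _ ↦ ?_
    by_cases hj : (j : ℕ) < m
    · rw [hp i j hi hj, zero_mul]
    · rw [hv j (not_lt.1 hj), mul_zero]
  exact conj_mem_map_ker _ hps hu

/-- Linear characters of `GL_4` are trivial on `U_{2,2}`. -/
theorem character_geomU (ω : Matrix.GeneralLinearGroup (Fin 4) A →* ℂˣ)
    {g : Matrix.GeneralLinearGroup (Fin 4) A} (hg : g ∈ geomU A 4 2) : ω g = 1 := by
  rw [mem_geomU_iff] at hg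
  -- All products of two matrix units from the upper right block vanish, so the four factors simply
  -- add.
  have : g = elementary 0 2 (by decide) (g 0 2) * elementary 0 3 (by decide) (g 0 3) *
      elementary 1 2 (by decide) (g 1 2) * elementary 1 3 (by decide) (g 1 3) := by
    refine Units.ext ?_
    simp only [Units.val_mul, coe_elementary, mul_add, add_mul, mul_one, one_mul]
    simp only [Matrix.single_mul_single_of_ne _ _ _ _ (show (2 : Fin 4) ≠ 0 by decide),
      Matrix.single_mul_single_of_ne _ _ _ _ (show (2 : Fin 4) ≠ 1 by decide),
      Matrix.single_mul_single_of_ne _ _ _ _ (show (3 : Fin 4) ≠ 1 by decide), add_zero, zero_mul]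
    ext i j
    have h := hg i j
    fin_cases i <;> fin_cases j <;> simp_all [Matrix.one_apply]
  rw [this, map_mul, map_mul, map_mul, character_elementary_four, character_elementary_four,
    character_elementary_four, character_elementary_four]
  simp

end Stabilizers

/-! ### Support of fixed vectors in an induced representation -/

section InducedFromCharacter

open Representation

variable {G : Type*} [Group G] [Finite G] {H : Subgroup G}

/-- A vector of a twist of the representation induced from `χ` fixed by a group `K` is supported
at some `g` for which `χ` is trivial on `H ∩ g K g⁻¹`, up to the twist. -/
theorem exists_conj_of_fixed (χ : H →* ℂˣ) (ω : G →* ℂˣ) (K : Subgroup G)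
    {v : IndV H.subtype (charRep χ)} (hv0 : v ≠ 0)
    (hv : ∀ k ∈ K, twist ω (ind H.subtype (charRep χ)) k v = v) :
    ∃ g : G, ∀ k ∈ K, ω k = 1 → ∀ h : H, (h : G) = g * k * g⁻¹ → χ h = 1 := by
  obtain ⟨g, hg⟩ : ∃ g, indEv (charRep χ) (ind H.subtype (charRep χ) g v) ≠ 0 := by
    by_contra! hcon
    exact hv0 (eq_zero_of_indEv _ _ hcon)
  refine ⟨g, fun k hk hω h hh ↦ ?_⟩
  have h1 := hv k hk
  rw [twist_apply, hω, Units.val_one, one_smul] at h1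
  have h2 : indEv (charRep χ) (ind H.subtype (charRep χ) g v) =
      χ h * indEv (charRep χ) (ind H.subtype (charRep χ) g v) := by
    rw [← indEv_ind_charRep, hh, ← Module.End.mul_apply, ← map_mul, inv_mul_cancel_right, map_mul,
      Module.End.mul_apply, h1]
  exact Units.ext (mul_right_cancel₀ hg (by rw [← h2, Units.val_one, one_mul]))

end InducedFromCharacter

/-! ### Induced series in terms of fixed vectors -/

section Cuspidality

open Representation

variable {O : Type*} [CommRing O] [IsLocalRing O] {n k : ℕ} {V : Type*} [AddCommGroup V]
  [Module ℂ V] {V' : Type*} [AddCommGroup V'] [Module ℂ V']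

theorem isCuspidal_of_equiv {π : Representation ℂ (GLo O n k) V}
    {π' : Representation ℂ (GLo O n k) V'} (e : π.Equiv π') (h : IsCuspidal π) :
    IsCuspidal π' := by
  refine ⟨isIrreducible_of_equiv e h.1, fun χ ↦ ⟨?_, ?_⟩⟩
  · rintro ⟨n₁, h0, hn, W₁, i₁, i₂, i₃, W₂, j₁, j₂, j₃, σ₁, σ₂, hs⟩
    exact (h.2 χ).1 ⟨n₁, h0, hn, W₁, i₁, i₂, i₃, W₂, j₁, j₂, j₃, σ₁, σ₂,
      isSubrepOf_of_equiv (twistEquiv χ e) hs⟩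
  · rintro ⟨Λ, hΛ, W, i₁, i₂, i₃, σ, hs⟩
    exact (h.2 χ).2 ⟨Λ, hΛ, W, i₁, i₂, i₃, σ, isSubrepOf_of_equiv (twistEquiv χ e) hs⟩

variable [Finite (oMod O k)]

/-- Inflated data are trivial on `U`, so Frobenius reciprocity and averaging give a fixed vector. -/
theorem exists_fixed_of_isGeomInduced [Nontrivial V] {π : Representation ℂ (GLo O n k) V}
    (h : IsGeomInduced π) : ∃ n₁, 0 < n₁ ∧ n₁ < n ∧
      ∃ v : V, v ≠ 0 ∧ ∀ u ∈ geomU (oMod O k) n n₁, π u v = v := by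
  obtain ⟨n₁, h0, hn, W₁, i₁, i₂, i₃, W₂, j₁, j₂, j₃, σ₁, σ₂, hs⟩ := h
  refine ⟨n₁, h0, hn, exists_fixed_of_isSubrepOf_ind _ π hs _ ?_⟩
  rintro _ ⟨q, hq, rfl⟩
  obtain ⟨h1, h2⟩ := (mem_ker_prod_iff _ q).1 hq
  refine ⟨q.2, ?_⟩
  rw [Representation.tprod_apply]
  change TensorProduct.map (σ₁ (resHom _ q)) (σ₂ (quotHom _ q)) = 1
  rw [h1, h2, map_one, map_one, TensorProduct.map_one]

theorem exists_fixed_of_isInfInduced [Nontrivial V] {π : Representation ℂ (GLo O n k) V}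
    (h : IsInfInduced π) : ∃ Λ : Fin n → ℕ, IsProperPartition n k Λ ∧
      ∃ v : V, v ≠ 0 ∧ ∀ u ∈ (resHom (embSub O n k Λ)).ker.map (stab (embSub O n k Λ)).subtype,
        π u v = v := by
  obtain ⟨Λ, hΛ, W, i₁, i₂, i₃, σ, hs⟩ := h
  refine ⟨Λ, hΛ, exists_fixed_of_isSubrepOf_ind _ π hs _ ?_⟩
  rintro _ ⟨q, hq, rfl⟩
  refine ⟨q.2, ?_⟩
  change σ (resHom _ q) = 1
  rw [MonoidHom.mem_ker.1 hq, map_one]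

/-- The converse. The inducing data need not be irreducible, so regular representations of the two
finite Levi factors suffice. -/
theorem isGeomInduced_of_fixed {π : Representation ℂ (GLo O n k) V} (hπ : π.IsIrreducible)
    {n₁ : ℕ} (h0 : 0 < n₁) (hn : n₁ < n) {v : V} (hv0 : v ≠ 0)
    (hv : ∀ u ∈ geomU (oMod O k) n n₁, π u v = v) : IsGeomInduced π := by
  have : Finite (coordSub (oMod O k) n n₁ ≃ₗ[oMod O k] coordSub (oMod O k) n n₁) :=
    Finite.of_injective _ DFunLike.coe_injective
  have : Finite ((Fin n → oMod O k) ⧸ coordSub (oMod O k) n n₁) :=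
    Finite.of_surjective _ (Submodule.mkQ_surjective _)
  have : Finite (((Fin n → oMod O k) ⧸ coordSub (oMod O k) n n₁) ≃ₗ[oMod O k]
      ((Fin n → oMod O k) ⧸ coordSub (oMod O k) n n₁)) :=
    Finite.of_injective _ DFunLike.coe_injective
  refine ⟨n₁, h0, hn, exists_isSubrepOf_ind_tprod hπ (resHom (coordSub (oMod O k) n n₁))
    (quotHom (coordSub (oMod O k) n n₁)) hv0 fun h h1 h2 ↦ hv _ ⟨h, ?_, rfl⟩⟩
  exact (mem_ker_prod_iff _ h).2 ⟨h1, h2⟩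

/-- For a proper partition, the elementary matrices `1 + ϖ t E_{in}` act trivially on `𝔬_Λ`. -/
theorem elementary_mem_ker_resHom {Λ : Fin n → ℕ} (hΛ : IsProperPartition n 2 Λ) {i j : Fin n}
    (hij : i ≠ j) (hj : ∀ l, l ≤ j) {a : oMod O 2} (ha : redMap O a = 0) :
    elementary i j hij a ∈ (resHom (embSub O n 2 Λ)).ker.map (stab (embSub O n 2 Λ)).subtype := by
  refine mem_ker_resHom_of_forall fun v hv ↦ ?_
  obtain ⟨hanti, hle, -, ⟨l, hl⟩⟩ := hΛ
  -- Some part is not 2, so the last and smallest part is at most 1. The last coordinate of a vector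
  -- in `𝔬_Λ` thus lies in `𝔭`, and multiplying it by `a` in `𝔭` gives zero.
  have h1 : Λ j ≤ 1 := (hanti (hj l)).trans (by have := hle l; omega)
  have h2 : a * v j = 0 := by
    have hv2 : v j ∈ (IsLocalRing.maximalIdeal O).map
        (Ideal.Quotient.mk (IsLocalRing.maximalIdeal O ^ 2)) :=
      Ideal.map_mono (Ideal.pow_le_self (by omega)) (hv j)
    obtain ⟨y, hy, hy'⟩ := (Ideal.mem_map_iff_of_surjective _ Ideal.Quotient.mk_surjective).1 hv2
    obtain ⟨x, rfl⟩ := Ideal.Quotient.mk_surjective a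
    rw [redMap_mk, IsLocalRing.residue_eq_zero_iff] at ha
    rw [← hy', ← map_mul, Ideal.Quotient.eq_zero_iff_mem, pow_two]
    exact Ideal.mul_mem_mul ha hy
  rw [glAut_apply, coe_elementary, Matrix.add_mulVec, Matrix.one_mulVec, Matrix.single_mulVec, h2]
  simp

end Cuspidality

/-! ### Linear characters of the stabilizer extending `ψ_β` -/

section Extensions

open Representation

variable {O : Type*} [CommRing O] [IsLocalRing O] {n : ℕ} {F : Type*} [Field F] [Algebra O F]

/-- The linear character `χ` of the stabilizer of `ψ_β` extends `ψ_β`. -/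
def Extends (ψ : AddChar F ℂˣ) (ϖ : O)
    (β : Matrix (Fin n) (Fin n) (IsLocalRing.ResidueField O)) (χ : stabPsi ψ ϖ β →* ℂˣ) : Prop :=
  ∀ (x : stabPsi ψ ϖ β) (hx : (x : GLo O n 2) ∈ N1 O n), χ x = psiBeta ψ ϖ β ⟨x, hx⟩

/-- An element of `O` with nonzero residue is a unit, so invertibility of the determinant can be
tested modulo `𝔭`. -/
theorem exists_unit_of_map (M : Matrix (Fin n) (Fin n) (oMod O 2))
    (u : Matrix.GeneralLinearGroup (Fin n) (IsLocalRing.ResidueField O))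
    (h : M.map (redMap O) = u) : ∃ a : GLo O n 2, a.val = M ∧ redGL O n a = u := by
  have hdet : IsUnit M.det := by
    obtain ⟨y, hy⟩ := Ideal.Quotient.mk_surjective M.det
    have h1 : IsUnit (redMap O M.det) := by
      rw [RingHom.map_det]
      change IsUnit (M.map (redMap O)).det
      rw [h]
      exact (Matrix.isUnit_iff_isUnit_det _).1 u.isUnit
    rw [← hy, redMap_mk] at h1
    rw [← hy]
    exact ((isUnit_map_iff _ y).1 h1).map _
  obtain ⟨a, ha⟩ := (Matrix.isUnit_iff_isUnit_det M).2 hdet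
  exact ⟨a, ha, Units.ext (by rw [coe_redGL, ha, h])⟩

theorem eq_mul_of_redGL_eq {a g : GLo O n 2} (h : redGL O n a = redGL O n g) :
    ∃ x : N1 O n, g = a * x := by
  refine ⟨⟨a⁻¹ * g, ?_⟩, by simp⟩
  rw [N1, MonoidHom.mem_ker]
  change redGL O n (a⁻¹ * g) = 1
  rw [map_mul, map_inv, h, inv_mul_cancel]

variable {ψ : AddChar F ℂˣ} {ϖ : O} {β : Matrix (Fin n) (Fin n) (IsLocalRing.ResidueField O)}
  (hN : N1 O n ≤ stabPsi ψ ϖ β)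

include hN in
theorem Extends.inclusion {χ : stabPsi ψ ϖ β →* ℂˣ} (hχ : Extends ψ ϖ β χ) (x : N1 O n) :
    χ (Subgroup.inclusion hN x) = psiBeta ψ ϖ β x := hχ _ x.2

include hN in
theorem Extends.exists_ne {χ : stabPsi ψ ϖ β →* ℂˣ} (hχ : Extends ψ ϖ β χ) :
    ∀ g ∉ stabPsi ψ ϖ β, ∃ x : N1 O n, χ (Subgroup.inclusion hN (MulAut.conjNormal g x)) ≠
      χ (Subgroup.inclusion hN x) := by
  intro g hg
  by_contra! hcon
  refine hg fun x ↦ ?_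
  rw [← hχ.inclusion hN, ← hχ.inclusion hN, hcon]

theorem isIrreducible_ind_of_extends [Finite (oMod O 2)] (hN : N1 O n ≤ stabPsi ψ ϖ β)
    {χ : stabPsi ψ ϖ β →* ℂˣ} (hχ : Extends ψ ϖ β χ) :
    (ind (stabPsi ψ ϖ β).subtype (charRep χ)).IsIrreducible :=
  ind_charRep_isIrreducible hN χ (hχ.exists_ne hN)

/-- Commutators of the stabilizer of `ψ_β` lie in `N_1`, and `ψ_β` is trivial on them. -/
def TrivialOnCommutators (ψ : AddChar F ℂˣ) (ϖ : O)
    (β : Matrix (Fin n) (Fin n) (IsLocalRing.ResidueField O)) : Prop :=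
  ∀ h k : stabPsi ψ ϖ β, ∃ hc : (h * k * h⁻¹ * k⁻¹ : GLo O n 2) ∈ N1 O n,
    psiBeta ψ ϖ β ⟨_, hc⟩ = 1

/-- The stabilizer preserves the `ψ_β`-isotypic subspace, and commutators act on it through `ψ_β`,
that is, trivially. The action there is commutative and so has an eigenvector. -/
theorem exists_eigenvector_of_psiBeta [Finite (oMod O 2)] (hc : TrivialOnCommutators ψ ϖ β)
    {W : Type*} [AddCommGroup W] [Module ℂ W] (ρ : Representation ℂ (stabPsi ψ ϖ β) W)
    (hρ : ContainsPsi ψ ϖ β ρ) :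
    ∃ w : W, w ≠ 0 ∧ ∃ χ, Extends ψ ϖ β χ ∧ ∀ h, ρ h w = (χ h : ℂ) • w := by
  obtain ⟨w₀, hw₀, hw₀'⟩ := hρ
  let S : Submodule ℂ W :=
    { carrier := {w | ∀ (x : stabPsi ψ ϖ β) (hx : (x : GLo O n 2) ∈ N1 O n),
        ρ x w = (psiBeta ψ ϖ β ⟨x, hx⟩ : ℂ) • w}
      zero_mem' := fun x hx ↦ by simp
      add_mem' := fun {a b} ha hb x hx ↦ by rw [map_add, ha x hx, hb x hx, smul_add]
      smul_mem' := fun c a ha x hx ↦ by rw [map_smul, ha x hx, smul_comm] }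
  have hS : ∀ h, ∀ w ∈ S, ρ h w ∈ S := by
    intro h w hw x hx
    have h1 : x * h = h * (h⁻¹ * x * h) := by group
    have h2 : ((h⁻¹ * x * h : stabPsi ψ ϖ β) : GLo O n 2) =
        (MulAut.conjNormal (h⁻¹ : GLo O n 2) (⟨x, hx⟩ : N1 O n) : N1 O n) := by
      rw [MulAut.conjNormal_apply]
      simp
    have h3 : ((h⁻¹ * x * h : stabPsi ψ ϖ β) : GLo O n 2) ∈ N1 O n := by
      rw [h2]; exact Subtype.prop _
    rw [← Module.End.mul_apply, ← map_mul, h1, map_mul, Module.End.mul_apply, hw _ h3, map_smul]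
    congr 2
    have h4 := (inv_mem h.2 : (h : GLo O n 2)⁻¹ ∈ stabPsi ψ ϖ β) ⟨x, hx⟩
    rw [← h4]
    congr 1
  have hcomm : ∀ h k, ∀ w ∈ S, ρ h (ρ k w) = ρ k (ρ h w) := by
    intro h k w hw
    obtain ⟨hc, hc1⟩ := hc h k
    have h1 : h * k = (h * k * h⁻¹ * k⁻¹) * (k * h) := by group
    have h2 := hS k _ (hS h w hw) (h * k * h⁻¹ * k⁻¹) hc
    have h3 : psiBeta ψ ϖ β ⟨((h * k * h⁻¹ * k⁻¹ : stabPsi ψ ϖ β) : GLo O n 2), hc⟩ = 1 := hc1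
    rw [h3, Units.val_one, one_smul] at h2
    rw [← Module.End.mul_apply, ← map_mul, h1, map_mul, map_mul ρ k h]
    exact h2
  obtain ⟨w, hw, hw0, χ, hχ⟩ := exists_eigenvector ρ S hS hcomm hw₀' hw₀
  refine ⟨w, hw0, χ, fun x hx ↦ ?_, hχ⟩
  have h1 := hχ x
  rw [hw x hx] at h1
  exact Units.ext (smul_left_injective ℂ hw0 h1).symm

theorem exists_equiv_charRep [Finite (oMod O 2)] (hc : TrivialOnCommutators ψ ϖ β)
    {W : Type*} [AddCommGroup W] [Module ℂ W] {ρ : Representation ℂ (stabPsi ψ ϖ β) W}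
    (hirr : ρ.IsIrreducible) (hρ : ContainsPsi ψ ϖ β ρ) :
    ∃ χ, Extends ψ ϖ β χ ∧ Nonempty (ρ.Equiv (charRep χ)) := by
  obtain ⟨w, hw0, χ, hχ, hw⟩ := exists_eigenvector_of_psiBeta hc ρ hρ
  exact ⟨χ, hχ, nonempty_equiv_charRep hirr χ hw0 hw⟩

/-- An eigenvector for the stabilizer gives, by Frobenius reciprocity, a nonzero map from `Ind χ` to
`π`; both are irreducible. -/
theorem exists_equiv_ind [Finite (oMod O 2)] (hN : N1 O n ≤ stabPsi ψ ϖ β)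
    (hc : TrivialOnCommutators ψ ϖ β) {V : Type*} [AddCommGroup V] [Module ℂ V]
    {π : Representation ℂ (GLo O n 2) V} (hπ : π.IsIrreducible) (hβ : β ∈ orbit ψ ϖ π) :
    ∃ χ, Extends ψ ϖ β χ ∧ Nonempty (π.Equiv (ind (stabPsi ψ ϖ β).subtype (charRep χ))) := by
  obtain ⟨v, hv0, hv⟩ := hβ
  obtain ⟨w, hw0, χ, hχ, hw⟩ := exists_eigenvector_of_psiBeta hc
    (MonoidHom.comp π (stabPsi ψ ϖ β).subtype) ⟨v, hv0, fun x hx ↦ hv ⟨x, hx⟩⟩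
  have := isIrreducible_ind_of_extends hN hχ
  refine ⟨χ, hχ, ?_⟩
  let f : IntertwiningMap (ind (stabPsi ψ ϖ β).subtype (charRep χ)) π :=
    indLift (LinearMap.toSpanSingleton ℂ V w) fun h a ↦ by
      rw [LinearMap.toSpanSingleton_apply, LinearMap.toSpanSingleton_apply, charRep_apply, map_smul]
      change _ = a • (MonoidHom.comp π (stabPsi ψ ϖ β).subtype) h w
      rw [hw, smul_smul, mul_comm]
  have hf : f ≠ 0 := by
    intro h0
    have h1 : f (IndV.mk _ (charRep χ) 1 (1 : ℂ)) = w := by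
      rw [indLift_mk]
      simp
    rw [h0] at h1
    exact hw0 h1.symm
  exact ⟨(f.ofBijective ((IsIrreducible.bijective_or_eq_zero f).resolve_right hf)).symm⟩

theorem extends_unique [Finite (oMod O 2)] (hN : N1 O n ≤ stabPsi ψ ϖ β)
    {χ χ' : stabPsi ψ ϖ β →* ℂˣ} (hχ : Extends ψ ϖ β χ) (hχ' : Extends ψ ϖ β χ')
    (e : (ind (stabPsi ψ ϖ β).subtype (charRep χ')).Equiv
      (ind (stabPsi ψ ϖ β).subtype (charRep χ))) : χ = χ' :=
  eq_of_ind_equiv hN χ χ' (hχ.exists_ne hN)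
    (fun x ↦ by rw [hχ.inclusion hN, hχ'.inclusion hN]) e

theorem mem_orbit_ind {χ : stabPsi ψ ϖ β →* ℂˣ} (hN : N1 O n ≤ stabPsi ψ ϖ β)
    (hχ : Extends ψ ϖ β χ) : β ∈ orbit ψ ϖ (ind (stabPsi ψ ϖ β).subtype (charRep χ)) := by
  refine ⟨IndV.mk _ (charRep χ) 1 (1 : ℂ), fun h ↦ ?_, fun x ↦ ?_⟩
  · have := indEv_mk_of_mem (charRep χ) (stabPsi ψ ϖ β).one_mem 1
    rw [h, map_zero, charRep_apply, mul_one] at this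
    exact (χ _).ne_zero this.symm
  · rw [← hχ.inclusion hN, ← Subgroup.coe_inclusion hN, ind_mk_one_of_mem, charRep_apply,
      ← map_smul, smul_eq_mul]

theorem mem_orbit_of_equiv {V V' : Type*} [AddCommGroup V] [Module ℂ V] [AddCommGroup V']
    [Module ℂ V'] {π : Representation ℂ (GLo O n 2) V} {π' : Representation ℂ (GLo O n 2) V'}
    (e : π.Equiv π') (h : β ∈ orbit ψ ϖ π) : β ∈ orbit ψ ϖ π' := by
  obtain ⟨v, hv0, hv⟩ := h
  exact ⟨e v, equiv_ne_zero e hv0, fun x ↦ by rw [← equiv_apply, hv, equiv_map_smul]⟩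

theorem containsTrivial_iff {G : Type*} [Group G] {W : Type*} [AddCommGroup W] [Module ℂ W]
    {ρ : Representation ℂ G W} {χ : G →* ℂˣ} (e : ρ.Equiv (charRep χ)) (U : Subgroup G) :
    ContainsTrivial ρ U ↔ ∀ u ∈ U, χ u = 1 := by
  constructor
  · rintro ⟨v, hv0, hv⟩ u hu
    have h1 := equiv_apply e u v
    rw [hv u hu, charRep_apply] at h1
    exact Units.ext (mul_right_cancel₀ (equiv_ne_zero e hv0) (by rw [← h1, Units.val_one, one_mul]))
  · intro h
    refine ⟨e.symm (1 : ℂ), equiv_ne_zero e.symm one_ne_zero, fun u hu ↦ ?_⟩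
    rw [← equiv_apply, charRep_apply, h u hu, Units.val_one, one_mul]

/-- `ψ_β` extends to its stabilizer, with a nontrivial value at any given element outside
`N_1`. -/
theorem exists_extends [Finite (oMod O 2)] (hψ : ∀ x : O, ψ (algebraMap O F x) = 1)
    (hϖ : IsLocalRing.maximalIdeal O = Ideal.span {ϖ}) (hϖ0 : algebraMap O F ϖ ≠ 0)
    (hN : N1 O n ≤ stabPsi ψ ϖ β) (hc : TrivialOnCommutators ψ ϖ β) (u : stabPsi ψ ϖ β)
    (hu : (u : GLo O n 2) ∉ N1 O n) : ∃ χ, Extends ψ ϖ β χ ∧ χ u ≠ 1 := by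
  obtain ⟨χ, hχ, hχu⟩ := exists_extension ((N1 O n).subgroupOf (stabPsi ψ ϖ β))
    ((psiHom hψ hϖ hϖ0 β).comp (Subgroup.subgroupOfEquivOfLe hN).toMonoidHom)
    (fun h x ↦ by
      have h1 := h.2 (Subgroup.subgroupOfEquivOfLe hN x)
      rw [← psiHom_apply hψ hϖ hϖ0, ← psiHom_apply hψ hϖ hϖ0] at h1
      rw [MonoidHom.comp_apply, MonoidHom.comp_apply]
      exact Eq.trans (congrArg _ (Subtype.ext rfl)) h1)
    (fun h k ↦ by
      obtain ⟨hc1, hc2⟩ := hc h k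
      exact ⟨hc1, hc2⟩) (u := u) hu
  exact ⟨χ, fun x hx ↦ hχ ⟨x, hx⟩, hχu⟩

end Extensions

/-! ### The cuspidality criterion for the orbit of `(η, 1; 0, η)` -/

section JordanMatrix

open Representation

variable {O : Type*} [CommRing O] [IsLocalRing O] {F : Type*} [Field F] [Algebra O F]
  {ψ : AddChar F ℂˣ} (hψ : ∀ x : O, ψ (algebraMap O F x) = 1)
  {ϖ : O} (hϖ : IsLocalRing.maximalIdeal O = Ideal.span {ϖ}) (hϖ0 : algebraMap O F ϖ ≠ 0)
  (hψ' : ∃ x : O, ψ ((algebraMap O F ϖ)⁻¹ * algebraMap O F x) ≠ 1)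
  {t c : IsLocalRing.ResidueField O}

theorem blocks_map {R S : Type*} (f : R → S) (A B C D : Matrix (Fin 2) (Fin 2) R) :
    (blocks A B C D).map f = blocks (A.map f) (B.map f) (C.map f) (D.map f) := by
  rw [blocks, blocks, Matrix.reindex_apply, Matrix.reindex_apply, ← Matrix.fromBlocks_map,
    Matrix.submatrix_map]

theorem centMat_map {R S : Type*} [CommRing R] [CommRing S] (f : R →+* S) (t c p q r s : R) :
    (centMat t c p q r s).map f = centMat (f t) (f c) (f p) (f q) (f r) (f s) := by
  have h : ∀ a b : R, (a • (1 : Matrix (Fin 2) (Fin 2) R) + b • etaMat t c).map f =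
      f a • 1 + f b • etaMat (f t) (f c) := by
    intro a b
    ext i j
    fin_cases i <;> fin_cases j <;> simp
  rw [centMat, blocks_map, h, h, Matrix.map_zero _ (map_zero f), centMat]

-- Lifting the coordinates `p, q, r, s, t, c` to `𝔬_2` lifts centralizer elements to matrices that
-- still commute. Every stabilizer element is such a lift times an element of `N1`.
include hψ hψ' hϖ hϖ0 in
theorem trivialOnCommutators_jordanMat (hD : t * t - 4 * c ≠ 0) :
    TrivialOnCommutators ψ ϖ (jordanMat t c) := by
  obtain ⟨t', rfl⟩ := redMap_surjective t
  obtain ⟨c', rfl⟩ := redMap_surjective c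
  have hN := N1_le_stabPsi hψ hϖ hϖ0 hψ' (jordanMat (redMap O t') (redMap O c'))
  have key : ∀ h ∈ stabPsi ψ ϖ (jordanMat (redMap O t') (redMap O c')), ∃ (a : GLo O 4 2)
      (x : N1 O 4), (∃ p q r s, a.val = centMat t' c' p q r s) ∧ h = a * x := by
    intro h hh
    rw [mem_stabPsi_iff hψ hϖ hϖ0 hψ'] at hh
    obtain ⟨p, q, r, s, hM⟩ := exists_eq_centMat hD hh
    obtain ⟨p, rfl⟩ := redMap_surjective p
    obtain ⟨q, rfl⟩ := redMap_surjective q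
    obtain ⟨r, rfl⟩ := redMap_surjective r
    obtain ⟨s, rfl⟩ := redMap_surjective s
    obtain ⟨a, ha, ha'⟩ := exists_unit_of_map (centMat t' c' p q r s) (redGL O 4 h)
      (by rw [centMat_map, hM])
    obtain ⟨x, hx⟩ := eq_mul_of_redGL_eq ha'
    exact ⟨a, x, ⟨p, q, r, s, ha⟩, hx⟩
  intro h k
  obtain ⟨a, x, ⟨p, q, r, s, ha⟩, hax⟩ := key h h.2
  obtain ⟨b, y, ⟨p', q', r', s', hb⟩, hby⟩ := key k k.2
  have hab : a * b = b * a := Units.ext (by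
    rw [Units.val_mul, Units.val_mul, ha, hb, centMat_commute])
  have ha' : a ∈ stabPsi ψ ϖ (jordanMat (redMap O t') (redMap O c')) := by
    have := mul_mem h.2 (hN (inv_mem x.2))
    rwa [hax, mul_inv_cancel_right] at this
  have hb' : b ∈ stabPsi ψ ϖ (jordanMat (redMap O t') (redMap O c')) := by
    have := mul_mem k.2 (hN (inv_mem y.2))
    rwa [hby, mul_inv_cancel_right] at this
  have hz : ∀ z : GLo O 4 2, z = (a * x) * (b * y) * (a * x)⁻¹ * (b * y)⁻¹ →
      ∃ hc : z ∈ N1 O 4, psiBeta ψ ϖ (jordanMat (redMap O t') (redMap O c')) ⟨z, hc⟩ = 1 := by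
    rintro _ rfl
    exact psiBeta_commutator hψ hϖ hϖ0 _ a b x y ha' hb' hN hab
  exact hz _ (by rw [Subgroup.coe_inv, Subgroup.coe_inv, hax, hby])

-- For `a` in `𝔭` the conjugated elementary matrix lies in `N1`, where `χ` is `ψ_β`. Triviality of
-- `χ` there is a condition on one entry of `g⁻¹ β g`.
include hψ hψ' hϖ hϖ0 in
theorem conj_entry_eq_zero {n : ℕ} {β : Matrix (Fin n) (Fin n) (IsLocalRing.ResidueField O)}
    {χ : stabPsi ψ ϖ β →* ℂˣ} (hχ : Extends ψ ϖ β χ) (g : GLo O n 2) {i j : Fin n} (hij : i ≠ j)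
    (h : ∀ a : oMod O 2, redMap O a = 0 → ∀ y : stabPsi ψ ϖ β,
      (y : GLo O n 2) = g * elementary i j hij a * g⁻¹ → χ y = 1) :
    (((redGL O n g)⁻¹).val * β * (redGL O n g).val) j i = 0 := by
  have hN := N1_le_stabPsi hψ hϖ hϖ0 hψ' β
  refine eq_of_psiBeta_single hψ hϖ hϖ0 hψ' _ 0 i j fun x ↦ ?_
  have h0 : (0 : Matrix (Fin n) (Fin n) (IsLocalRing.ResidueField O)) =
      (0 : Matrix (Fin n) (Fin n) O).map (IsLocalRing.residue O) := by
    rw [Matrix.map_zero _ (map_zero _)]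
  rw [← psiBeta_conj hψ hϖ hϖ0, h0, psiBeta_oneAdd hψ hϖ hϖ0, zero_mul, Matrix.trace_zero, map_zero,
    mul_zero, AddChar.map_zero_eq_one, ← hχ.inclusion hN]
  refine h (Ideal.Quotient.mk _ (ϖ * x)) ?_ _ ?_
  · rw [redMap_mk, IsLocalRing.residue_eq_zero_iff, hϖ]
    exact Ideal.mul_mem_right _ _ (Ideal.mem_span_singleton_self ϖ)
  · rw [Subgroup.coe_inclusion, MulAut.conjNormal_apply]
    congr 2
    refine Units.ext ?_
    rw [coe_oneAdd, coe_elementary, map_one_add_smul]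
    ext k l
    simp [Matrix.single_apply]

theorem blocks_lower_left {R : Type*} [Zero R] {A B C D : Matrix (Fin 2) (Fin 2) R} :
    C = 0 ↔ ∀ i j : Fin 4, 2 ≤ (i : ℕ) → (j : ℕ) < 2 → blocks A B C D i j = 0 := by
  constructor
  · rintro rfl i j hi hj
    fin_cases i <;> fin_cases j <;> first | rfl | simp at hi hj
  · intro h
    ext i j
    have h1 := h (Fin.natAdd 2 i) (Fin.castAdd 2 j) (by simp) j.2
    rw [blocks, Matrix.reindex_apply, Matrix.submatrix_apply, finSumFinEquiv_symm_apply_natAdd,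
      finSumFinEquiv_symm_apply_castAdd, Matrix.fromBlocks_apply₂₁] at h1
    exact h1

include hψ hψ' hϖ hϖ0 in
/-- If the orbit is that of `(η, 1; 0, η)` and `χ` is nontrivial on `U_{2,2} ∩ G(ψ_β)`, the
representation induced from `χ` is cuspidal. -/
theorem isCuspidal_ind [Finite (oMod O 2)] (hD : t * t - 4 * c ≠ 0)
    (ha : ∀ x y, x * x + t * x * y + c * y * y = 0 → x = 0 ∧ y = 0)
    {χ : stabPsi ψ ϖ (jordanMat t c) →* ℂˣ} (hχ : Extends ψ ϖ (jordanMat t c) χ)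
    (hU : ¬ ∀ u ∈ (geomU (oMod O 2) 4 2).subgroupOf (stabPsi ψ ϖ (jordanMat t c)), χ u = 1) :
    IsCuspidal (ind (stabPsi ψ ϖ (jordanMat t c)).subtype (charRep χ)) := by
  have hN := N1_le_stabPsi hψ hϖ hϖ0 hψ' (jordanMat t c)
  have hirr := isIrreducible_ind_of_extends hN hχ
  have hnt := nontrivial_of_isIrreducible hirr
  refine ⟨hirr, fun ω ↦ ⟨fun hind ↦ ?_, fun hind ↦ ?_⟩⟩
  · obtain ⟨n₁, h0, hn, v, hv0, hv⟩ := exists_fixed_of_isGeomInduced hind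
    obtain ⟨g, hg⟩ := exists_conj_of_fixed χ ω _ hv0 hv
    have hentry : ∀ i j : Fin 4, (j : ℕ) < n₁ → n₁ ≤ i →
        (((redGL O 4 g)⁻¹).val * jordanMat t c * (redGL O 4 g).val) i j = 0 := by
      intro i j hj hi
      have hji : j ≠ i := fun h ↦ by subst h; omega
      exact conj_entry_eq_zero hψ hϖ hϖ0 hψ' hχ g hji fun a _ y hy ↦
        hg _ (elementary_mem_geomU hj hi a) (character_elementary_four ω hji a) y hy
    -- The vanishing block means an invariant subspace of dimension `n₁`: a line or a hyperplane is
    -- impossible, and a plane must be the standard one.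
    interval_cases n₁
    · obtain ⟨i, hi, hi'⟩ := conj_jordanMat_column ha (redGL O 4 g) 0
      exact hi' (hentry i 0 (by simp) (Nat.one_le_iff_ne_zero.2 fun h ↦ hi (Fin.ext h)))
    · refine hU fun u hu ↦ ?_
      obtain ⟨A, B, C, D, hABCD⟩ := exists_eq_blocks (redGL O 4 g).val
      obtain ⟨A', B', C', D', hABCD'⟩ := exists_eq_blocks
        (((redGL O 4 g)⁻¹).val * jordanMat t c * (redGL O 4 g).val)
      have hC' : C' = 0 := blocks_lower_left.2 fun i j hi hj ↦ by
        rw [← hABCD']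
        exact hentry i j hj hi
      have hC : C = 0 := by
        refine eq_zero_of_invariant hD ha (A := A) (B := B) (D := D) (A' := A') (B' := B')
          (D' := D') ?_
        rw [← hC', ← hABCD', ← hABCD, ← mul_assoc, ← mul_assoc, ← Units.val_mul, mul_inv_cancel,
          Units.val_one, one_mul]
      have hlow : ∀ i j : Fin 4, 2 ≤ (i : ℕ) → (j : ℕ) < 2 → redMap O (g.val i j) = 0 := by
        intro i j hi hj
        have := (blocks_lower_left (A := A) (B := B) (D := D)).1 hC i j hi hj
        rwa [← hABCD, coe_redGL, Matrix.map_apply] at this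
      -- Replacing the lower left block of `g`, which is zero modulo `𝔭`, by zero gives an element
      -- `p` normalizing `U_{2,2}` and congruent to `g` modulo `N1`.
      obtain ⟨p, hp, hp'⟩ := exists_unit_of_map
        (Matrix.of fun i j : Fin 4 ↦ if 2 ≤ (i : ℕ) ∧ (j : ℕ) < 2 then 0 else g.val i j)
        (redGL O 4 g) (by
          ext i j
          rw [coe_redGL, Matrix.map_apply, Matrix.map_apply, Matrix.of_apply]
          split_ifs with h
          · rw [hlow i j h.1 h.2, map_zero]
          · rfl)
      obtain ⟨x, hx⟩ := eq_mul_of_redGL_eq hp'.symm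
      have hk : p⁻¹ * u * p ∈ geomU (oMod O 2) 4 2 := conj_mem_geomU (fun i j hi hj ↦ by
        change p.val i j = 0
        rw [hp, Matrix.of_apply, if_pos ⟨hi, hj⟩]) hu
      -- Here `g = y⁻¹ p`, so conjugating `p⁻¹ u p` by `g` gives `y⁻¹ u y`, on which `χ` takes the
      -- value `χ(u)`.
      let y : stabPsi ψ ϖ (jordanMat t c) := Subgroup.inclusion hN (MulAut.conjNormal p x)
      have h1 := hg _ hk (character_geomU ω hk) (y⁻¹ * u * y) (by
        simp only [y, Subgroup.coe_mul, Subgroup.coe_inv, Subgroup.coe_inclusion,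
          MulAut.conjNormal_apply]
        have : g = (p * (x : GLo O 4 2) * p⁻¹)⁻¹ * p := by
          rw [hx]
          group
        rw [this]
        group)
      rwa [map_mul, map_mul, map_inv, mul_comm, mul_inv_cancel_left] at h1
    · obtain ⟨j, hj, hj'⟩ := conj_jordanMat_row ha (redGL O 4 g) 3
      exact hj' (hentry 3 j (by have := j.2; have : (j : ℕ) ≠ 3 := fun h ↦ hj (Fin.ext h); omega)
        le_rfl)
  -- Whatever the partition, the elements `1 + a E_{j3}` with `a` in `𝔭` act trivially on `𝔬_Λ`.
  -- Hence the last row of `g⁻¹ β g` vanishes off the diagonal, which would give an invariant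
  -- hyperplane.
  · obtain ⟨Λ, hΛ, v, hv0, hv⟩ := exists_fixed_of_isInfInduced hind
    obtain ⟨g, hg⟩ := exists_conj_of_fixed χ ω _ hv0 hv
    obtain ⟨j, hj, hj'⟩ := conj_jordanMat_row ha (redGL O 4 g) 3
    exact hj' (conj_entry_eq_zero hψ hϖ hϖ0 hψ' hχ g hj fun a ha0 y hy ↦
      hg _ (elementary_mem_ker_resHom hΛ hj (fun l ↦ Fin.le_last l) ha0)
        (character_elementary_four ω hj a) y hy)

/-- Averaging the generator over `U_{2,2}` gives a nonzero fixed vector, so an irreducible `Ind χ`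
is geometrically induced without any twist. -/
theorem not_isCuspidal_ind [Finite (oMod O 2)] {β : Matrix (Fin 4) (Fin 4) _}
    {χ : stabPsi ψ ϖ β →* ℂˣ}
    (hU : ∀ u ∈ (geomU (oMod O 2) 4 2).subgroupOf (stabPsi ψ ϖ β), χ u = 1) :
    ¬ IsCuspidal (ind (stabPsi ψ ϖ β).subtype (charRep χ)) := by
  intro h
  obtain ⟨v, hv0, hv⟩ := exists_fixed_ind_charRep χ (geomU (oMod O 2) 4 2)
    fun u hu ↦ hU u hu
  refine (h.2 1).1 ?_
  rw [twist_one]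
  exact isGeomInduced_of_fixed h.1 two_pos (by norm_num) hv0 hv

include hψ hψ' hϖ hϖ0 in
theorem isCuspidal_ind_iff [Finite (oMod O 2)] (hD : t * t - 4 * c ≠ 0)
    (ha : ∀ x y, x * x + t * x * y + c * y * y = 0 → x = 0 ∧ y = 0) {W : Type*} [AddCommGroup W]
    [Module ℂ W] {ρ : Representation ℂ (stabPsi ψ ϖ (jordanMat t c)) W} (hρ : ρ.IsIrreducible)
    (hρψ : ContainsPsi ψ ϖ (jordanMat t c) ρ) :
    IsCuspidal (ind (stabPsi ψ ϖ (jordanMat t c)).subtype ρ) ↔ ¬ ContainsTrivial ρ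
      ((geomU (oMod O 2) 4 2).subgroupOf (stabPsi ψ ϖ (jordanMat t c))) := by
  obtain ⟨χ, hχ, ⟨e⟩⟩ := exists_equiv_charRep
    (trivialOnCommutators_jordanMat hψ hϖ hϖ0 hψ' hD) hρ hρψ
  obtain ⟨e'⟩ := nonempty_ind_equiv ρ e
  rw [containsTrivial_iff e]
  constructor
  · exact fun h hU ↦ not_isCuspidal_ind hU (isCuspidal_of_equiv e' h)
  · exact fun hU ↦ isCuspidal_of_equiv e'.symm (isCuspidal_ind hψ hϖ hϖ0 hψ' hD ha hχ hU)

include hψ hψ' hϖ hϖ0 in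
/-- `1 + E_{13} + E_{24}` fixes the character attached to `(η, 1; 0, η)`. -/
theorem exists_mem_geomU_stabPsi : ∃ u : stabPsi ψ ϖ (jordanMat t c),
    (u : GLo O 4 2) ∈ geomU (oMod O 2) 4 2 ∧ (u : GLo O 4 2) ∉ N1 O 4 := by
  obtain ⟨t', rfl⟩ := redMap_surjective t
  obtain ⟨c', rfl⟩ := redMap_surjective c
  have hinv : ∀ a b : oMod O 2, a + b = 0 →
      centMat t' c' 1 0 a 0 * centMat t' c' 1 0 b 0 = 1 := by
    intro a b hab
    have h1 : (1 : Matrix (Fin 4) (Fin 4) (oMod O 2)) = blocks 1 0 0 1 := by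
      rw [blocks, Matrix.fromBlocks_one, Matrix.reindex_apply, Matrix.submatrix_one_equiv]
    rw [h1, centMat, centMat, blocks_mul, blocks_inj]
    simp [← add_smul, add_comm b a, hab]
  let u : GLo O 4 2 := ⟨centMat t' c' 1 0 1 0, centMat t' c' 1 0 (-1) 0, hinv _ _ (by simp),
    hinv _ _ (by simp)⟩
  have hu : u.val = centMat t' c' 1 0 1 0 := rfl
  have hmem : u ∈ stabPsi ψ ϖ (jordanMat (redMap O t') (redMap O c')) := by
    rw [mem_stabPsi_iff hψ hϖ hϖ0 hψ', coe_redGL, hu, centMat_map, jordanMat_eq_centMat,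
      centMat_commute]
  refine ⟨⟨u, hmem⟩, ?_, fun h ↦ ?_⟩
  · rw [mem_geomU_iff]
    intro i j hij
    change centMat t' c' 1 0 1 0 i j = _
    rw [centMat, one_smul, zero_smul, add_zero]
    fin_cases i <;> fin_cases j <;> first | rfl | simp at hij
  · have h1 := congrFun (congrFun ((mem_N1_iff _).1 h) 0) 2
    rw [Matrix.map_apply] at h1
    change redMap O (centMat t' c' 1 0 1 0 0 2) = 0 at h1
    rw [centMat, one_smul, zero_smul, add_zero] at h1
    change redMap O 1 = 0 at h1
    rw [map_one] at h1
    exact one_ne_zero h1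

/-- The matrix `(η, 1; 0, η)` leaves a plane invariant. -/
theorem not_isIrreducibleMatrix_jordanMat {κ : Type*} [Field κ] (t c : κ) :
    ¬ IsIrreducibleMatrix (jordanMat t c) := by
  intro h
  have hinv : ∀ v ∈ coordSub κ 4 2, (jordanMat t c).mulVec v ∈ coordSub κ 4 2 := by
    intro v hv i hi
    change ∑ j, jordanMat t c i j * v j = 0
    refine Finset.sum_eq_zero fun j _ ↦ ?_
    by_cases hj : (j : ℕ) < 2
    · exact mul_eq_zero_of_left (blocks_lower_left.1 rfl i j hi hj) _
    · exact mul_eq_zero_of_right _ (hv j (not_lt.1 hj))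
  rcases h _ hinv with h1 | h1
  · have h2 : (Pi.single 0 1 : Fin 4 → κ) ∈ coordSub κ 4 2 := fun i hi ↦
      Pi.single_eq_of_ne (by rintro rfl; simp at hi) 1
    rw [h1, Submodule.mem_bot] at h2
    have := congrFun h2 0
    simp at this
  · have h2 : (Pi.single 3 1 : Fin 4 → κ) ∈ coordSub κ 4 2 := by rw [h1]; trivial
    have := h2 3 (by simp)
    simp at this

end JordanMatrix

/-! ### Change of universe -/

section Universe

/-- A representation can be moved to a larger universe. -/
theorem exists_ulift_equiv {G V : Type*} [Group G] [AddCommGroup V] [Module ℂ V]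
    (τ : Representation ℂ G V) :
    ∃ σ : Representation ℂ G (ULift.{w} V), Nonempty (τ.Equiv σ) := by
  let σ : Representation ℂ G (ULift.{w} V) :=
    { toFun := fun g ↦ ULift.moduleEquiv.symm.toLinearMap ∘ₗ τ g ∘ₗ ULift.moduleEquiv.toLinearMap
      map_one' := by ext; simp
      map_mul' := fun a b ↦ by ext; simp }
  exact ⟨σ, ⟨.mk ULift.moduleEquiv.symm fun g ↦ by ext; simp [σ]⟩⟩

end Universe

end CuspidalGL

end

/-! ### The main theorem -/

open CuspidalGL in
theorem mainTheorem7
    {F : Type u} [Field F] [ValuativeRel F] [TopologicalSpace F] [IsNonarchimedeanLocalField F]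
    (ϖ : 𝒪[F]) (hϖ : Irreducible ϖ)
    (ψ : AddChar F ℂˣ) (hψ : ∀ x : 𝒪[F], ψ (x : F) = 1)
    (hψ' : ∃ x : 𝒪[F], ψ ((ϖ : F)⁻¹ * x) ≠ 1)
    {E : Type*} [Field E] [Algebra 𝓀[F] E] (hE : Module.finrank 𝓀[F] E = 2)
    (η : E) (hη : IntermediateField.adjoin 𝓀[F] {η} = ⊤)
    (b : Module.Basis (Fin 2) 𝓀[F] E) (hb : ⇑b = ![1, η])
    (β₁ : Matrix (Fin 4) (Fin 4) 𝓀[F]) (hβ₁ : β₁ = betaOne b η)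
    (Gψ : Subgroup (GLo 𝒪[F] 4 2)) (hGψ : Gψ = stabPsi ψ ϖ β₁)
    (U : Subgroup Gψ) (hU : U = (geomU (oMod 𝒪[F] 2) 4 2).subgroupOf Gψ) :
    -- every irreducible `π` with `β₁` in its orbit is induced from a unique linear character
    -- of `G(ψ_{β₁})` extending `ψ_{β₁}`
    (∀ (V : Type v) [AddCommGroup V] [Module ℂ V] (π : Representation ℂ (GLo 𝒪[F] 4 2) V),
      π.IsIrreducible → β₁ ∈ orbit ψ ϖ π →
        ∃! χ : Gψ →* ℂˣ,
          (∀ (x : Gψ) (hx : (x : GLo 𝒪[F] 4 2) ∈ N1 𝒪[F] 4), χ x = psiBeta ψ ϖ β₁ ⟨x, hx⟩) ∧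
          Nonempty (π.Equiv (Representation.ind Gψ.subtype (charRep χ)))) ∧
    -- the criterion for cuspidality
    (∀ (V : Type v) [AddCommGroup V] [Module ℂ V] (π : Representation ℂ (GLo 𝒪[F] 4 2) V)
      (W : Type w) [AddCommGroup W] [Module ℂ W] (ρ : Representation ℂ Gψ W),
      π.IsIrreducible → β₁ ∈ orbit ψ ϖ π →
      ρ.IsIrreducible → ContainsPsi ψ ϖ β₁ ρ →
      Nonempty (π.Equiv (Representation.ind Gψ.subtype ρ)) →
        (IsCuspidal π ↔ ¬ ContainsTrivial ρ U)) ∧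
    -- induction is a well-defined map between the two sets of isomorphism classes,
    (∀ (W : Type w) [AddCommGroup W] [Module ℂ W] (ρ : Representation ℂ Gψ W),
      ρ.IsIrreducible → ContainsPsi ψ ϖ β₁ ρ → ¬ ContainsTrivial ρ U →
        IsCuspidal (Representation.ind Gψ.subtype ρ) ∧
        β₁ ∈ orbit ψ ϖ (Representation.ind Gψ.subtype ρ)) ∧
    -- it is injective,
    (∀ (W : Type w) [AddCommGroup W] [Module ℂ W] (ρ : Representation ℂ Gψ W)
      (W' : Type w) [AddCommGroup W'] [Module ℂ W'] (ρ' : Representation ℂ Gψ W'),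
      ρ.IsIrreducible → ContainsPsi ψ ϖ β₁ ρ → ¬ ContainsTrivial ρ U →
      ρ'.IsIrreducible → ContainsPsi ψ ϖ β₁ ρ' → ¬ ContainsTrivial ρ' U →
      Nonempty ((Representation.ind Gψ.subtype ρ).Equiv (Representation.ind Gψ.subtype ρ')) →
        Nonempty (ρ.Equiv ρ')) ∧
    -- and it is surjective
    (∀ (V : Type v) [AddCommGroup V] [Module ℂ V] (π : Representation ℂ (GLo 𝒪[F] 4 2) V),
      IsCuspidal π → β₁ ∈ orbit ψ ϖ π →
        ∃ (W : Type w) (_ : AddCommGroup W) (_ : Module ℂ W) (ρ : Representation ℂ Gψ W),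
          ρ.IsIrreducible ∧ ContainsPsi ψ ϖ β₁ ρ ∧ ¬ ContainsTrivial ρ U ∧
          Nonempty (π.Equiv (Representation.ind Gψ.subtype ρ))) ∧
    -- some of these cuspidal representations are not strongly cuspidal
    (∃ (V : Type u) (_ : AddCommGroup V) (_ : Module ℂ V)
      (π : Representation ℂ (GLo 𝒪[F] 4 2) V),
      IsCuspidal π ∧ β₁ ∈ orbit ψ ϖ π ∧ ¬ IsStronglyCuspidal ψ ϖ π) := by
  classical
  have hϖm : IsLocalRing.maximalIdeal 𝒪[F] = Ideal.span {ϖ} := hϖ.maximalIdeal_eq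
  have hϖ0 : algebraMap 𝒪[F] F ϖ ≠ 0 := fun h ↦ hϖ.ne_zero (Subtype.ext h)
  have : Finite (oMod 𝒪[F] 2) := by
    have : Finite (𝒪[F] ⧸ IsLocalRing.maximalIdeal 𝒪[F]) := inferInstanceAs (Finite 𝓀[F])
    exact Ideal.finite_quotient_pow (IsNoetherian.noetherian _) 2
  obtain ⟨t, c, hη2⟩ : ∃ t c, η * η = algebraMap 𝓀[F] E t * η - algebraMap 𝓀[F] E c :=
    ⟨_, _, eta_sq hb⟩
  have hD := quadratic_discriminant_ne_zero hb hη2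
  have ha := quadratic_anisotropic hb hη2
  rw [betaOne_eq hb hη2] at hβ₁
  subst hβ₁ hGψ hU
  have hN := N1_le_stabPsi hψ hϖm hϖ0 hψ' (jordanMat t c)
  have hc := trivialOnCommutators_jordanMat hψ hϖm hϖ0 hψ' hD
  refine ⟨?_, ?_, ?_, ?_, ?_, ?_⟩
  · intro V _ _ π hπ hβ
    obtain ⟨χ, hχ, ⟨e⟩⟩ := exists_equiv_ind hN hc hπ hβ
    refine ⟨χ, ⟨hχ, ⟨e⟩⟩, ?_⟩
    rintro χ' ⟨hχ', ⟨e'⟩⟩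
    exact extends_unique hN hχ' hχ (e.symm.trans e')
  · intro V _ _ π W _ _ ρ _ _ hρ hρψ ⟨e⟩
    rw [← isCuspidal_ind_iff hψ hϖm hϖ0 hψ' hD ha hρ hρψ]
    exact ⟨isCuspidal_of_equiv e, isCuspidal_of_equiv e.symm⟩
  · intro W _ _ ρ hρ hρψ hU
    refine ⟨(isCuspidal_ind_iff hψ hϖm hϖ0 hψ' hD ha hρ hρψ).2 hU, ?_⟩
    obtain ⟨χ, hχ, ⟨e⟩⟩ := exists_equiv_charRep hc hρ hρψ
    obtain ⟨e'⟩ := nonempty_ind_equiv ρ e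
    exact mem_orbit_of_equiv e'.symm (mem_orbit_ind hN hχ)
  · intro W _ _ ρ W' _ _ ρ' hρ hρψ _ hρ' hρψ' _ ⟨f⟩
    obtain ⟨χ, hχ, ⟨e⟩⟩ := exists_equiv_charRep hc hρ hρψ
    obtain ⟨χ', hχ', ⟨e'⟩⟩ := exists_equiv_charRep hc hρ' hρψ'
    obtain ⟨i⟩ := nonempty_ind_equiv ρ e
    obtain ⟨i'⟩ := nonempty_ind_equiv ρ' e'
    have h := extends_unique hN hχ hχ' (i'.symm.trans (f.symm.trans i))
    subst h
    exact ⟨e.trans e'.symm⟩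
  · intro V _ _ π hπ hβ
    obtain ⟨χ, hχ, ⟨e⟩⟩ := exists_equiv_ind hN hc hπ.1 hβ
    -- The character acts on `ℂ`, in the lowest universe; surjectivity asks for a space in universe
    -- `w`.
    obtain ⟨ρ, ⟨i⟩⟩ := exists_ulift_equiv.{w} (charRep χ)
    have hρ := isIrreducible_of_equiv i (charRep_isIrreducible χ)
    have hρψ : ContainsPsi ψ ϖ (jordanMat t c) ρ := ⟨i (1 : ℂ), equiv_ne_zero i one_ne_zero,
      fun x hx ↦ by
        rw [← equiv_apply, charRep_apply, hχ x hx, ← equiv_map_smul, smul_eq_mul]⟩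
    obtain ⟨i'⟩ := nonempty_ind_equiv _ i
    have e' := e.trans i'
    exact ⟨_, _, _, ρ, hρ, hρψ, (isCuspidal_ind_iff hψ hϖm hϖ0 hψ' hD ha hρ hρψ).1
      (isCuspidal_of_equiv e' hπ), ⟨e'⟩⟩
  -- An extension of `ψ_β` that is nontrivial at this element of `U_{2,2}` induces to a cuspidal
  -- representation, whose orbit contains the reducible matrix `β₁`.
  · obtain ⟨u, huU, huN⟩ := exists_mem_geomU_stabPsi hψ hϖm hϖ0 hψ'
    obtain ⟨χ, hχ, hχu⟩ := exists_extends hψ hϖm hϖ0 hN hc u huN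
    have horb := mem_orbit_ind hN hχ
    exact ⟨_, _, _, _, isCuspidal_ind hψ hϖm hϖ0 hψ' hD ha hχ fun h ↦ hχu (h u huU), horb,
      fun h ↦ not_isIrreducibleMatrix_jordanMat _ _ (h.2 _ horb)⟩
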